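/- Let $d\ge 2$ and $\mathbb T^d=\mathbb R^d/\mathbb Z^d$ (row vectors), with Lebesgue measure. Let $A$ be a $d\times d$ upper-triangular integer matrix with all diagonal entries equal to $1$, let $\mathbf b\in\mathbb T^d$, and suppose that the skew-translation $T\mathbf x=\mathbf xA+\mathbf b$ of $\mathbb T^d$ is ergodic with respect to Lebesgue measure. Let $\pi:\mathbb T^d\to\mathbb T^{d-1}$ be the projection onto the first $d-1$ coordinates and let $\widehat T\mathbf y=\mathbf y\widehat A+\pi(\mathbf b)$ be the corresponding factor map of $\mathbb T^{d-1}$, where $\widehat A$ is $A$ with the last row and the last column removed. Let $\psi:\mathbb T^{d-1}\to\mathbb R_{>0}$ be smooth ($C^\infty$). For a measure-preserving bijection $S$ of a probability space $(X,\mu)$ and an integrable roof function $\Psi:X\to\mathbb R_{>0}$ bounded away from $0$, the suspension flow $\{S^\Psi_t\}_{t\in\mathbb R}$ is the flow $[x,r]\mapsto[x,r+t]$ on the quotient of $X\times\mathbb R$ by the equivalence relation generated by $(x,r+\Psi(x))\sim(Sx,r)$, $x\in X$, $r\in\mathbb R$, with its invariant probability measure, namely the image of $(\int\Psi\,d\mu)^{-1}\,d\mu\,dr$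 restricted to $\{(x,r):0\le r<\Psi(x)\}$. A flow $\{\phi_t\}$ preserving a probability measure $m$ is mixing if $m(R\cap\phi_t^{-1}Q)\to m(R)\,m(Q)$ as $t\to\infty$ for all measurable $R,Q$. If there exist $\mathbf v\in\mathbb Z^d$ and $a\neq0$ with $\mathbf vA=\mathbf v+a\,\mathbf e_d$, then the suspension flow $\{T_t^{\psi\circ\pi}\}_{t\in\mathbb R}$ over $(\mathbb T^d,T)$ is mixing if and only if the suspension flow $\{\widehat T_t^{\psi}\}_{t\in\mathbb R}$ over $(\mathbb T^{d-1},\widehat T)$ is mixing. -/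

import Mathlib

open MeasureTheory Filter Topology Matrix

/-- The skew-translation `x ↦ x A + b` of the torus `𝕋^d = (ℝ/ℤ)^d`, points being row vectors. -/
def skewTranslation {d : ℕ} (A : Matrix (Fin d) (Fin d) ℤ) (b : UnitAddTorus (Fin d)) :
    UnitAddTorus (Fin d) → UnitAddTorus (Fin d) :=
  fun x j => ∑ i, A i j • x i + b j

/-- `A` is upper triangular with all diagonal entries equal to `1`. -/
def IsUpperUnipotent {d : ℕ} (A : Matrix (Fin d) (Fin d) ℤ) : Prop :=
  (∀ i j, j < i → A i j = 0) ∧ ∀ i, A i i = 1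

/-- The projection of `𝕋^(n+1)` onto the first `n` coordinates. -/
def torusProj {n : ℕ} (x : UnitAddTorus (Fin (n + 1))) : UnitAddTorus (Fin n) :=
  fun i => x i.castSucc

/-- The matrix obtained by removing the last row and the last column. -/
def dropLast {n : ℕ} (A : Matrix (Fin (n + 1)) (Fin (n + 1)) ℤ) : Matrix (Fin n) (Fin n) ℤ :=
  A.submatrix Fin.castSucc Fin.castSucc

/-- A function on the torus is smooth when its `ℤ^d`-periodic lift to `ℝ^d` is `C^∞`. -/
def TorusSmooth {d : ℕ} (f : UnitAddTorus (Fin d) → ℝ) : Prop :=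
  ContDiff ℝ (⊤ : ℕ∞) (fun y : Fin d → ℝ => f (fun i => (y i : UnitAddCircle)))

section Suspension

/-- The elementary identifications `(x, s + Ψ x) ∼ (T x, s)` on `X × ℝ`. -/
inductive SuspensionRel {X : Type*} (T : X → X) (Ψ : X → ℝ) : X × ℝ → X × ℝ → Prop
  | glue (x : X) (s : ℝ) : SuspensionRel T Ψ (x, s + Ψ x) (T x, s)

/-- The equivalence relation on `X × ℝ` generated by `(x, s + Ψ x) ∼ (T x, s)`. -/
def suspensionSetoid {X : Type*} (T : X → X) (Ψ : X → ℝ) : Setoid (X × ℝ) :=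
  Relation.EqvGen.setoid (SuspensionRel T Ψ)

/-- The suspension space over `(X, T)` with roof function `Ψ`. It carries the quotient
`σ`-algebra. -/
abbrev SuspensionSpace {X : Type*} (T : X → X) (Ψ : X → ℝ) : Type _ :=
  Quotient (suspensionSetoid T Ψ)

/-- Vertical translation is compatible with the identifications. -/
theorem suspensionSetoid_translate {X : Type*} (T : X → X) (Ψ : X → ℝ) (t : ℝ) (p q : X × ℝ)
    (h : suspensionSetoid T Ψ p q) :
    suspensionSetoid T Ψ (p.1, p.2 + t) (q.1, q.2 + t) := by
  induction h with
  | rel p q h =>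
    obtain ⟨x, s⟩ := h
    have := SuspensionRel.glue (T := T) (Ψ := Ψ) x (s + t)
    rw [add_right_comm] at this
    exact Relation.EqvGen.rel _ _ this
  | refl p => exact Relation.EqvGen.refl _
  | symm p q _ ih => exact Relation.EqvGen.symm _ _ ih
  | trans p q r _ _ ih₁ ih₂ => exact Relation.EqvGen.trans _ _ _ ih₁ ih₂

/-- The suspension flow: vertical translation at unit speed, `[x, r] ↦ [x, r + t]`. -/
def suspensionFlow {X : Type*} (T : X → X) (Ψ : X → ℝ) (t : ℝ) :
    SuspensionSpace T Ψ → SuspensionSpace T Ψ :=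
  Quotient.map (fun p => (p.1, p.2 + t)) (suspensionSetoid_translate T Ψ t)

/-- The region `{(x, r) : 0 ≤ r < Ψ x}` under the graph of the roof function. -/
def underRoof {X : Type*} (Ψ : X → ℝ) : Set (X × ℝ) :=
  {p | 0 ≤ p.2 ∧ p.2 < Ψ p.1}

/-- The normalized measure of the suspension flow: the image in the suspension space of `μ × dr`
restricted to the region under the roof and divided by its total mass `∫ Ψ dμ`. -/
noncomputable def suspensionMeasure {X : Type*} [MeasurableSpace X] (μ : Measure X)
    (T : X → X) (Ψ : X → ℝ) : Measure (SuspensionSpace T Ψ) :=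
  (ProbabilityTheory.cond (μ.prod volume) (underRoof Ψ)).map
    (Quotient.mk (suspensionSetoid T Ψ))

end Suspension

/-- The family of maps `φ t`, `t ∈ ℝ`, of the probability space `(Y, m)` is mixing: it preserves
`m` and `m (R ∩ (φ t)⁻¹ Q) → m R * m Q` as `t → ∞` for all measurable `R` and `Q`. -/
def IsMixingFlow {Y : Type*} [MeasurableSpace Y] (φ : ℝ → Y → Y) (m : Measure Y) : Prop :=
  (∀ t, MeasurePreserving (φ t) m m) ∧
    ∀ R Q : Set Y, MeasurableSet R → MeasurableSet Q →
      Tendsto (fun t : ℝ => m (R ∩ φ t ⁻¹' Q)) atTop (𝓝 (m R * m Q))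

/-- The suspension flow over the Lebesgue-measured torus map `T` with roof function `Ψ` is
mixing. -/
def SuspensionMixing {d : ℕ} (T : UnitAddTorus (Fin d) → UnitAddTorus (Fin d))
    (Ψ : UnitAddTorus (Fin d) → ℝ) : Prop :=
  IsMixingFlow (suspensionFlow T Ψ) (suspensionMeasure volume T Ψ)

/-! The flow over `dropLast A` is a factor of the flow over `A`, so mixing descends. The content is
the converse: the circle fibres of this factor map decorrelate by themselves, and the mechanism is a
shear.

Since vA = v + a e_d and e_d A = e_d, the orbit of x + τv is the orbit of x, displaced by τv and
drifting along the fibre by τa at each step (`iterate_skewTranslation_add_toTorus`). With τ =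
s/(ak), the point x moves by O(1/k) while the last coordinate of its k-th image turns by s. The roof
sums up to time k change by about τ times the Birkhoff sum of the derivative of ψ along v. That
derivative has mean zero, the base is uniquely ergodic and τ = O(1/k), so the change tends to zero
uniformly (`TorusSmooth.exists_abs_sum_increments_le`). Thus, for large k, every rotation of the
fibre at the k-th image is achieved by a tiny translation at the start
(`exists_translation_dist_lt`).

Lebesgue measure is translation invariant, so correlating a continuous h with f along the flow is
asymptotically the same as correlating h with f rotated along the fibre by any w, hence with the
fibre average of f. The correlation is a sum over numbers k of roof crossings. Each term is small
relative to the measure of the points that contribute to it, and those measures have bounded total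
because an orbit visits a bounded window of heights boundedly often
(`exists_abs_integral_mul_orbitSum_sub_fiberAverage_le`). An L¹ approximation passes to indicators.

For sets that are products of a set of the factor and an arc of the fibre, averaging leaves a
constant times a correlation of the factor, to which mixing below applies. These sets form a
generating π-system, and that suffices by `IsMixingFlow.of_isPiSystem`.

Unique ergodicity of the skew-translation is proved on characters, by van der Corput's inequality
and induction on the support of the frequency. -/

instance UnitAddCircle.instIsProbabilityMeasureVolume :
    IsProbabilityMeasure (volume : Measure UnitAddCircle) :=
  ⟨UnitAddCircle.measure_univ⟩

instance UnitAddTorus.instIsProbabilityMeasureVolume {n : ℕ} :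
    IsProbabilityMeasure (volume : Measure (UnitAddTorus (Fin n))) :=
  inferInstanceAs (IsProbabilityMeasure (Measure.pi fun _ => volume))

/-! ### Skew-translations and their projection to one dimension lower -/

section SkewTranslation

theorem continuous_skewTranslation {d : ℕ} (A : Matrix (Fin d) (Fin d) ℤ)
    (b : UnitAddTorus (Fin d)) : Continuous (skewTranslation A b) := by
  unfold skewTranslation
  fun_prop

theorem skewTranslation_one_zero {d : ℕ} (x : UnitAddTorus (Fin d)) :
    skewTranslation 1 0 x = x := by
  ext j
  simp [skewTranslation, Matrix.one_apply]

theorem skewTranslation_comp {d : ℕ} (A A' : Matrix (Fin d) (Fin d) ℤ)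
    (b b' x : UnitAddTorus (Fin d)) :
    skewTranslation A b (skewTranslation A' b' x) =
      skewTranslation (A' * A) (skewTranslation A b b') x := by
  ext j
  simp only [skewTranslation, Matrix.mul_apply, smul_add, Finset.sum_add_distrib, Finset.smul_sum,
    Finset.sum_smul, smul_smul]
  rw [Finset.sum_comm, add_assoc]
  simp only [mul_comm]

theorem exists_leftInverse_skewTranslation {d : ℕ} {A B : Matrix (Fin d) (Fin d) ℤ}
    (h : A * B = 1) (b : UnitAddTorus (Fin d)) :
    ∃ c, Function.LeftInverse (skewTranslation B c) (skewTranslation A b) := by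
  refine ⟨-(skewTranslation B 0 b), fun x => ?_⟩
  rw [skewTranslation_comp, h]
  have : skewTranslation B (-(skewTranslation B 0 b)) b = 0 := by
    ext j
    simp [skewTranslation]
  rw [this, skewTranslation_one_zero]

theorem IsUpperUnipotent.det_eq_one {d : ℕ} {A : Matrix (Fin d) (Fin d) ℤ}
    (hA : IsUpperUnipotent A) : A.det = 1 := by
  rw [Matrix.det_of_isUpperTriangular (fun i j h => hA.1 i j h)]
  simp [hA.2]

theorem IsUpperUnipotent.exists_measurableEquiv {d : ℕ} {A : Matrix (Fin d) (Fin d) ℤ}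
    (hA : IsUpperUnipotent A) (b : UnitAddTorus (Fin d)) :
    ∃ e : UnitAddTorus (Fin d) ≃ᵐ UnitAddTorus (Fin d), ⇑e = skewTranslation A b := by
  have hu : IsUnit A.det := by rw [hA.det_eq_one]; exact isUnit_one
  obtain ⟨c, hc⟩ := exists_leftInverse_skewTranslation (Matrix.mul_nonsing_inv A hu) b
  obtain ⟨b', hb'⟩ := exists_leftInverse_skewTranslation (Matrix.nonsing_inv_mul A hu) c
  refine ⟨⟨⟨skewTranslation A b, skewTranslation A⁻¹ c, hc, fun x => ?_⟩, ?_, ?_⟩, rfl⟩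
  · apply hb'.injective
    rw [hc]
  · exact (continuous_skewTranslation _ _).measurable
  · exact (continuous_skewTranslation _ _).measurable

theorem IsUpperUnipotent.dropLast {n : ℕ} {A : Matrix (Fin (n + 1)) (Fin (n + 1)) ℤ}
    (hA : IsUpperUnipotent A) : IsUpperUnipotent (dropLast A) :=
  ⟨fun i j h => hA.1 _ _ (by simpa using h), fun i => hA.2 _⟩

theorem continuous_torusProj {n : ℕ} :
    Continuous (torusProj : UnitAddTorus (Fin (n + 1)) → UnitAddTorus (Fin n)) := by
  unfold torusProj
  fun_prop

theorem torusProj_skewTranslation {n : ℕ} {A : Matrix (Fin (n + 1)) (Fin (n + 1)) ℤ}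
    (hA : IsUpperUnipotent A) (b x : UnitAddTorus (Fin (n + 1))) :
    torusProj (skewTranslation A b x) =
      skewTranslation (_root_.dropLast A) (torusProj b) (torusProj x) := by
  ext j
  simp [torusProj, skewTranslation, _root_.dropLast, Fin.sum_univ_castSucc,
    hA.1 (Fin.last n) j.castSucc (Fin.castSucc_lt_last j)]

/-- The splitting of the torus into its last coordinate and its first coordinates. -/
noncomputable def torusSplit (n : ℕ) :
    UnitAddTorus (Fin (n + 1)) ≃ᵐ UnitAddCircle × UnitAddTorus (Fin n) :=
  MeasurableEquiv.piFinSuccAbove (fun _ => UnitAddCircle) (Fin.last n)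

theorem torusSplit_apply {n : ℕ} (x : UnitAddTorus (Fin (n + 1))) :
    torusSplit n x = (x (Fin.last n), torusProj x) := by
  ext
  · rfl
  · simp [torusSplit, MeasurableEquiv.piFinSuccAbove, torusProj, Fin.init]

theorem measurePreserving_torusSplit (n : ℕ) : MeasurePreserving (torusSplit n) :=
  volume_preserving_piFinSuccAbove (fun _ => UnitAddCircle) (Fin.last n)

theorem measurePreserving_torusProj (n : ℕ) :
    MeasurePreserving (torusProj : UnitAddTorus (Fin (n + 1)) → UnitAddTorus (Fin n)) := by
  have := (measurePreserving_snd (μ := (volume : Measure UnitAddCircle))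
    (ν := (volume : Measure (UnitAddTorus (Fin n))))).comp (measurePreserving_torusSplit n)
  have h : torusProj = Prod.snd ∘ torusSplit n := by
    funext x
    rw [Function.comp_apply, torusSplit_apply]
  rwa [h]

/-- Ergodicity passes to factors. It is needed below because the increments of ψ are summed along
orbits of the factor. -/
theorem ergodic_skewTranslation_dropLast {n : ℕ} {A : Matrix (Fin (n + 1)) (Fin (n + 1)) ℤ}
    (hA : IsUpperUnipotent A) {b : UnitAddTorus (Fin (n + 1))}
    (hT : Ergodic (skewTranslation A b) volume) :
    Ergodic (skewTranslation (_root_.dropLast A) (torusProj b)) volume :=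
  (measurePreserving_torusProj n).ergodic_of_ergodic_semiconj hT
    (continuous_skewTranslation _ _).measurable (torusProj_skewTranslation hA b)

end SkewTranslation

/-! ### Uniform convergence of Birkhoff averages and van der Corput's inequality -/

section UniformAverages

/-- The Birkhoff averages of `g` along `T` tend to zero uniformly. -/
def UniformlyZeroAverages {X E : Type*} [NormedAddCommGroup E] (T : X → X) (g : X → E) : Prop :=
  ∀ ε : ℝ, 0 < ε → ∃ N₀ : ℕ, ∀ N, N₀ ≤ N → ∀ x, ‖birkhoffSum T g N x‖ ≤ ε * N

/-- Shifting the range of summation changes only h terms at either end. -/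
theorem norm_sum_range_shift_sub_le (u : ℕ → ℂ) (hu : ∀ j, ‖u j‖ ≤ 1) (N h : ℕ) :
    ‖∑ j ∈ Finset.range N, u (j + h) - ∑ j ∈ Finset.range N, u j‖ ≤ 2 * h := by
  have key : ∑ j ∈ Finset.range N, u (j + h) - ∑ j ∈ Finset.range N, u j =
      ∑ j ∈ Finset.range h, u (N + j) - ∑ j ∈ Finset.range h, u j := by
    have h1 := Finset.sum_range_add u h N
    have h2 := Finset.sum_range_add u N h
    rw [add_comm h N, h2] at h1
    simp only [add_comm h] at h1
    linear_combination -h1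
  have hb : ∀ w : ℕ → ℕ, ‖∑ j ∈ Finset.range h, u (w j)‖ ≤ h := fun w => by
    simpa using norm_sum_le_of_le (Finset.range h) (fun j _ => hu (w j))
  rw [key]
  refine (norm_sub_le _ _).trans ?_
  have := hb (fun j => N + j)
  have := hb id
  simp only [id] at this
  linarith

/-- Expand the square into H² correlations. The H diagonal ones are at most N each; the others are
at most δN, the case h < h' being the conjugate of the case h' < h. -/
theorem sum_norm_sq_sum_range_le (u : ℕ → ℂ) (hu : ∀ j, ‖u j‖ ≤ 1) (N H : ℕ) {δ : ℝ}
    (hδ0 : 0 ≤ δ)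
    (hδ : ∀ h < H, ∀ h' < h, ‖∑ j ∈ Finset.range N, u (j + h) * star (u (j + h'))‖ ≤ δ * N) :
    ∑ j ∈ Finset.range N, ‖∑ h ∈ Finset.range H, u (j + h)‖ ^ 2 ≤
      H * N + H * (H * (δ * N)) := by
  have expand : ((∑ j ∈ Finset.range N, ‖∑ h ∈ Finset.range H, u (j + h)‖ ^ 2 : ℝ) : ℂ) =
      ∑ h ∈ Finset.range H, ∑ h' ∈ Finset.range H,
        ∑ j ∈ Finset.range N, u (j + h) * star (u (j + h')) := by
    rw [Finset.sum_congr rfl fun h _ => Finset.sum_comm, Finset.sum_comm]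
    push_cast
    refine Finset.sum_congr rfl fun j _ => ?_
    rw [← Complex.mul_conj', map_sum, Finset.sum_mul_sum]
    rfl
  have hterm : ∀ h ∈ Finset.range H, ∀ h' ∈ Finset.range H,
      ‖∑ j ∈ Finset.range N, u (j + h) * star (u (j + h'))‖ ≤
        (if h = h' then (N : ℝ) else 0) + (if h = h' then 0 else δ * N) := by
    intro h hh h' hh'
    rw [Finset.mem_range] at hh hh'
    rcases lt_trichotomy h' h with hlt | rfl | hlt
    · simpa [hlt.ne'] using hδ h hh h' hlt
    · simp only [if_true, add_zero]
      refine (norm_sum_le_of_le _ fun j _ => ?_).trans (by simp : ∑ j ∈ Finset.range N, (1 : ℝ) ≤ N)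
      rw [norm_mul, norm_star]
      exact mul_le_one₀ (hu _) (norm_nonneg _) (hu _)
    · have := hδ h' hh' h hlt
      rw [← norm_star, star_sum] at this
      simpa [hlt.ne, mul_comm] using this
  have hnn : 0 ≤ ∑ j ∈ Finset.range N, ‖∑ h ∈ Finset.range H, u (j + h)‖ ^ 2 :=
    Finset.sum_nonneg fun _ _ => by positivity
  rw [← Real.norm_of_nonneg hnn, ← Complex.norm_real, expand]
  refine (norm_sum_le_of_le _ fun h hh => norm_sum_le_of_le _ (hterm h hh)).trans ?_
  simp only [Finset.sum_add_distrib]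
  gcongr ?_ + ?_
  · simp only [Finset.sum_ite_eq, Finset.sum_ite_mem, Finset.inter_self]
    simp
  · calc _ ≤ ∑ h ∈ Finset.range H, ∑ h' ∈ Finset.range H, δ * N := by
          gcongr with h _ h' _
          split_ifs
          · positivity
          · exact le_rfl
      _ = _ := by simp

/-- A uniform form of van der Corput's difference theorem. -/
theorem UniformlyZeroAverages.of_vanDerCorput {X : Type*} {T : X → X} {f : X → ℂ}
    (hf : ∀ x, ‖f x‖ ≤ 1)
    (h : ∀ k : ℕ, 0 < k → UniformlyZeroAverages T fun x => f (T^[k] x) * star (f x)) :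
    UniformlyZeroAverages T f := by
  intro ε hε
  -- The target for the block sums is (NHε/2)². Half of it absorbs the diagonal, which requires H ≤
  -- H²ε²/8; the other half absorbs the correlations, taken at level ε²/8.
  obtain ⟨H, hH⟩ := exists_nat_gt (8 / ε ^ 2)
  have hH0 : (0 : ℝ) < H := lt_trans (by positivity) hH
  choose! N₀ hN₀ using fun k (hk : 0 < k) => h k hk (ε ^ 2 / 8) (by positivity)
  -- For N beyond this, the boundary error 2H² is at most NHε/2.
  obtain ⟨M, hM⟩ := exists_nat_gt (4 * H / ε)
  refine ⟨max M ((Finset.range H).sup N₀), fun N hN x => ?_⟩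
  set u : ℕ → ℂ := fun j => f (T^[j] x) with hu_def
  have hu : ∀ j, ‖u j‖ ≤ 1 := fun j => hf _
  have hcor : ∀ h < H, ∀ h' < h,
      ‖∑ j ∈ Finset.range N, u (j + h) * star (u (j + h'))‖ ≤ ε ^ 2 / 8 * N := by
    intro h hh h' hh'
    have hle : N₀ (h - h') ≤ N :=
      (Finset.le_sup (f := N₀) (Finset.mem_range.2 (by lia))).trans ((le_max_right _ _).trans hN)
    -- A correlation of shifts h and h' is one of lag h - h' started at `T^[h'] x`; uniformity in
    -- the starting point is used here.
    refine le_of_eq_of_le (congrArg _ ?_) (hN₀ (h - h') (by lia) N hle (T^[h'] x))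
    unfold birkhoffSum
    refine Finset.sum_congr rfl fun j _ => ?_
    simp only [hu_def, ← Function.iterate_add_apply]
    rw [show j + h = h - h' + (j + h') by lia]
  have hsq := sum_norm_sq_sum_range_le u hu N H (by positivity) hcor
  have hsum : ∑ j ∈ Finset.range N, ‖∑ h ∈ Finset.range H, u (j + h)‖ ≤ N * H * (ε / 2) := by
    refine abs_le_of_sq_le_sq' ?_ (by positivity) |>.2
    calc _ ≤ (Finset.range N).card * ∑ j ∈ Finset.range N,
            ‖∑ h ∈ Finset.range H, u (j + h)‖ ^ 2 := sq_sum_le_card_mul_sum_sq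
      _ ≤ N * (H * N + H * (H * (ε ^ 2 / 8 * N))) := by
          rw [Finset.card_range]
          gcongr
      _ ≤ (N * H * (ε / 2)) ^ 2 := by
          have : (H : ℝ) ≤ H * H * (ε ^ 2 / 8) := by
            rw [div_lt_iff₀ (by positivity)] at hH
            nlinarith
          nlinarith [mul_le_mul_of_nonneg_left this (by positivity : (0 : ℝ) ≤ N * N)]
  have hshift : ‖(H : ℂ) * ∑ j ∈ Finset.range N, u j‖ ≤ N * H * (ε / 2) + H * (2 * H) := by
    have hsplit : (H : ℂ) * ∑ j ∈ Finset.range N, u j =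
        ∑ j ∈ Finset.range N, ∑ h ∈ Finset.range H, u (j + h) - ∑ h ∈ Finset.range H,
          (∑ j ∈ Finset.range N, u (j + h) - ∑ j ∈ Finset.range N, u j) := by
      rw [Finset.sum_sub_distrib, Finset.sum_comm]
      simp
    rw [hsplit]
    refine (norm_sub_le _ _).trans (add_le_add ((norm_sum_le _ _).trans hsum) ?_)
    refine (norm_sum_le_of_le _ (f := fun h => ∑ j ∈ Finset.range N, u (j + h) -
      ∑ j ∈ Finset.range N, u j) (fun h hh => (norm_sum_range_shift_sub_le u hu N h).trans
        (?_ : _ ≤ 2 * (H : ℝ)))).trans (by simp)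
    have : (h : ℝ) ≤ H := by exact_mod_cast (Finset.mem_range.1 hh).le
    linarith
  rw [norm_mul, Complex.norm_natCast] at hshift
  have hNM : 4 * H / ε < (N : ℝ) := hM.trans_le (by exact_mod_cast (le_max_left _ _).trans hN)
  rw [div_lt_iff₀ hε] at hNM
  change ‖∑ j ∈ Finset.range N, u j‖ ≤ ε * N
  refine le_of_mul_le_mul_left (hshift.trans ?_) hH0
  nlinarith

end UniformAverages

section UniformAverages

theorem UniformlyZeroAverages.const_mul {X : Type*} {T : X → X} {f : X → ℂ}
    (hf : UniformlyZeroAverages T f) (c : ℂ) : UniformlyZeroAverages T fun x => c * f x := by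
  intro ε hε
  obtain ⟨N₀, hN₀⟩ := hf (ε / (‖c‖ + 1)) (by positivity)
  refine ⟨N₀, fun N hN x => ?_⟩
  have h := hN₀ N hN x
  have : birkhoffSum T (fun x => c * f x) N x = c * birkhoffSum T f N x := by
    simp only [birkhoffSum, Finset.mul_sum]
  rw [this, norm_mul]
  calc ‖c‖ * ‖birkhoffSum T f N x‖ ≤ (‖c‖ + 1) * (ε / (‖c‖ + 1) * N) := by
        gcongr
        linarith
    _ = ε * N := by field_simp

theorem UniformlyZeroAverages.add {X : Type*} {T : X → X} {f g : X → ℂ}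
    (hf : UniformlyZeroAverages T f) (hg : UniformlyZeroAverages T g) :
    UniformlyZeroAverages T (f + g) := by
  intro ε hε
  obtain ⟨N₁, h₁⟩ := hf (ε / 2) (by positivity)
  obtain ⟨N₂, h₂⟩ := hg (ε / 2) (by positivity)
  refine ⟨max N₁ N₂, fun N hN x => ?_⟩
  rw [birkhoffSum_add']
  refine (norm_add_le _ _).trans ?_
  have := h₁ N ((le_max_left _ _).trans hN) x
  have := h₂ N ((le_max_right _ _).trans hN) x
  linarith

theorem UniformlyZeroAverages.of_approx {X : Type*} {T : X → X} {f : X → ℂ}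
    (h : ∀ ε : ℝ, 0 < ε → ∃ g, UniformlyZeroAverages T g ∧ ∀ x, ‖f x - g x‖ ≤ ε) :
    UniformlyZeroAverages T f := by
  intro ε hε
  obtain ⟨g, hg, hfg⟩ := h (ε / 2) (by positivity)
  obtain ⟨N₀, hN₀⟩ := hg (ε / 2) (by positivity)
  refine ⟨N₀, fun N hN x => ?_⟩
  have h1 : ‖birkhoffSum T f N x - birkhoffSum T g N x‖ ≤ ε / 2 * N := by
    unfold birkhoffSum
    rw [← Finset.sum_sub_distrib]
    refine (norm_sum_le_of_le _ fun j _ => hfg _).trans (le_of_eq ?_)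
    simp [mul_comm]
  have h2 := hN₀ N hN x
  rw [norm_sub_rev] at h1
  linarith [norm_le_norm_add_norm_sub' (birkhoffSum T f N x) (birkhoffSum T g N x),
    norm_sub_rev (birkhoffSum T g N x) (birkhoffSum T f N x)]

end UniformAverages

/-! ### Characters under a skew-translation and unique ergodicity -/

section Characters

open UnitAddTorus

theorem mFourier_eq_toCircle {d : ℕ} (u : Fin d → ℤ) (x : UnitAddTorus (Fin d)) :
    mFourier u x = (AddCircle.toCircle (∑ i, u i • x i) : ℂ) := by
  have : ∀ s : Finset (Fin d), (AddCircle.toCircle (∑ i ∈ s, u i • x i) : ℂ) =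
      ∏ i ∈ s, fourier (u i) (x i) := by
    intro s
    induction s using Finset.induction_on with
    | empty => simp
    | insert a s ha ih =>
      rw [Finset.sum_insert ha, Finset.prod_insert ha, AddCircle.toCircle_add, Circle.coe_mul, ih,
        fourier_apply]
  rw [this]
  rfl

theorem norm_mFourier_apply {d : ℕ} (u : Fin d → ℤ) (x : UnitAddTorus (Fin d)) :
    ‖mFourier u x‖ = 1 := by
  rw [mFourier_eq_toCircle, Circle.norm_coe]

theorem mFourier_apply_add {d : ℕ} (u : Fin d → ℤ) (x y : UnitAddTorus (Fin d)) :
    mFourier u (x + y) = mFourier u x * mFourier u y := by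
  simp only [mFourier_eq_toCircle, Pi.add_apply, smul_add, Finset.sum_add_distrib,
    AddCircle.toCircle_add, Circle.coe_mul]

theorem mFourier_skewTranslation {d : ℕ} (A : Matrix (Fin d) (Fin d) ℤ) (u : Fin d → ℤ)
    (b x : UnitAddTorus (Fin d)) :
    mFourier u (skewTranslation A b x) = mFourier u b * mFourier (A *ᵥ u) x := by
  have : skewTranslation A b x = b + skewTranslation A 0 x := by
    ext j
    simp [skewTranslation, add_comm]
  rw [this, mFourier_apply_add, mFourier_eq_toCircle (A *ᵥ u), mFourier_eq_toCircle u (skewTranslation _ _ _)]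
  congr 3
  simp only [skewTranslation, Matrix.mulVec, dotProduct, Finset.sum_smul, Pi.zero_apply, add_zero,
    Finset.smul_sum, smul_smul]
  rw [Finset.sum_comm]
  simp only [mul_comm]

theorem exists_mFourier_iterate {d : ℕ} (A : Matrix (Fin d) (Fin d) ℤ) (b : UnitAddTorus (Fin d))
    (u : Fin d → ℤ) (k : ℕ) :
    ∃ c : ℂ, ∀ x, mFourier u ((skewTranslation A b)^[k] x) = c * mFourier ((A ^ k) *ᵥ u) x := by
  induction k generalizing u with
  | zero => exact ⟨1, by simp⟩
  | succ k ih =>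
    obtain ⟨c, hc⟩ := ih u
    refine ⟨c * mFourier ((A ^ k) *ᵥ u) b, fun x => ?_⟩
    rw [Function.iterate_succ_apply, hc, mFourier_skewTranslation, Matrix.mulVec_mulVec,
      ← pow_succ', mul_assoc]

/-- Translation by a point where the character equals -1 turns the integral into its negative. -/
theorem integral_mFourier {d : ℕ} {u : Fin d → ℤ} (hu : u ≠ 0) :
    ∫ x : UnitAddTorus (Fin d), mFourier u x = 0 := by
  obtain ⟨i, hi⟩ := Function.ne_iff.1 hu
  set y : UnitAddTorus (Fin d) := Pi.single i (((1 / 2 / (u i : ℝ) : ℝ)) : UnitAddCircle)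
  have hy : mFourier u y = -1 := by
    have hi' : (u i : ℝ) ≠ 0 := by exact_mod_cast hi
    have hsum : ∑ j, u j • y j = ((1 / 2 : ℝ) : UnitAddCircle) := by
      rw [Finset.sum_eq_single i (fun j _ hj => by simp [y, hj]) (by simp)]
      simp only [y, Pi.single_eq_same]
      rw [← AddCircle.coe_zsmul, zsmul_eq_mul]
      congr 1
      field_simp
    rw [mFourier_eq_toCircle, hsum, AddCircle.toCircle_apply_mk]
    simp only [div_one, Circle.coe_exp]
    rw [show (((2 * Real.pi * (1 / 2) : ℝ)) : ℂ) = Real.pi by push_cast; ring]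
    exact Complex.exp_pi_mul_I
  have h := integral_add_right_eq_self (μ := (volume : Measure (UnitAddTorus (Fin d))))
    (fun x => mFourier u x) y
  simp only [mFourier_apply_add, hy, mul_neg, mul_one, integral_neg] at h
  have : (2 : ℂ) * ∫ x : UnitAddTorus (Fin d), mFourier u x = 0 := by linear_combination -h
  simpa using this

/-- Above the diagonal, `A` can only feed later entries of `u` into earlier ones, so the last
nonzero entry and the zeros after it are preserved. -/
theorem IsUpperUnipotent.pow_mulVec_apply {d : ℕ} {A : Matrix (Fin d) (Fin d) ℤ}
    (hA : IsUpperUnipotent A) {u : Fin d → ℤ} {i : Fin d} (hu : ∀ j, i < j → u j = 0) (k : ℕ) :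
    ∀ j, i ≤ j → ((A ^ k) *ᵥ u) j = u j := by
  induction k with
  | zero => simp
  | succ k ih =>
    intro j hj
    rw [pow_succ', ← Matrix.mulVec_mulVec, Matrix.mulVec, dotProduct,
      Finset.sum_eq_single j, hA.2, one_mul, ih j hj]
    · intro l _ hl
      rcases lt_or_gt_of_ne hl with h | h
      · rw [hA.1 j l h, zero_mul]
      · rw [ih l (hj.trans h.le), hu l (hj.trans_lt h), mul_zero]
    · simp

/-- At the last index where Au - u is nonzero, each application of `A` adds the same nonzero
integer, so the entry never returns to its initial value. -/
theorem IsUpperUnipotent.pow_mulVec_ne {d : ℕ} {A : Matrix (Fin d) (Fin d) ℤ}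
    (hA : IsUpperUnipotent A) {u : Fin d → ℤ} (hu : A *ᵥ u ≠ u) {k : ℕ} (hk : 0 < k) :
    (A ^ k) *ᵥ u ≠ u := by
  set w := A *ᵥ u - u with hw
  have hw0 : w ≠ 0 := sub_ne_zero.2 hu
  have hne : (Finset.univ.filter fun i => w i ≠ 0).Nonempty := by
    obtain ⟨i, hi⟩ := Function.ne_iff.1 hw0
    exact ⟨i, by simpa using hi⟩
  obtain ⟨i, hi, hmax⟩ := Finset.exists_max_image _ id hne
  simp only [Finset.mem_filter, Finset.mem_univ, true_and, id] at hi hmax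
  have hz : ∀ j, i < j → w j = 0 := fun j hj => by
    by_contra h
    exact absurd (hmax j h) (not_le.2 hj)
  have hsum : ∀ k : ℕ, ((A ^ k) *ᵥ u) i - u i = k * w i := by
    intro k
    induction k with
    | zero => simp
    | succ k ih =>
      have h1 : (A ^ (k + 1)) *ᵥ u = (A ^ k) *ᵥ w + (A ^ k) *ᵥ u := by
        rw [hw, Matrix.mulVec_sub, Matrix.mulVec_mulVec, ← pow_succ, sub_add_cancel]
      rw [h1, Pi.add_apply, hA.pow_mulVec_apply hz k i le_rfl]
      push_cast
      linear_combination ih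
  intro h
  have := hsum k
  rw [h, sub_self] at this
  have : (k : ℤ) * w i ≠ 0 := mul_ne_zero (by exact_mod_cast hk.ne') hi
  lia

theorem uniformlyZeroAverages_of_eigenfunction {X : Type*} {T : X → X} {f : X → ℂ} {c : ℂ}
    (hc : c ≠ 1) (hc1 : ‖c‖ = 1) (hf : ∀ x, ‖f x‖ ≤ 1) (h : ∀ x, f (T x) = c * f x) :
    UniformlyZeroAverages T f := by
  intro ε hε
  have hit : ∀ k x, f (T^[k] x) = c ^ k * f x := by
    intro k
    induction k with
    | zero => simp
    | succ k ih =>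
      intro x
      rw [Function.iterate_succ_apply, ih, h]
      ring
  have hc0 : 0 < ‖c - 1‖ := norm_pos_iff.2 (sub_ne_zero.2 hc)
  obtain ⟨N₀, hN₀⟩ := exists_nat_gt (2 / ‖c - 1‖ / ε)
  refine ⟨N₀, fun N hN x => ?_⟩
  have : birkhoffSum T f N x = (c ^ N - 1) / (c - 1) * f x := by
    simp only [birkhoffSum, hit, ← Finset.sum_mul]
    rw [geom_sum_eq hc]
  rw [this, norm_mul, norm_div]
  have h2 : ‖c ^ N - 1‖ ≤ 2 := by
    refine (norm_sub_le _ _).trans ?_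
    rw [norm_pow, hc1]
    norm_num
  calc ‖c ^ N - 1‖ / ‖c - 1‖ * ‖f x‖ ≤ 2 / ‖c - 1‖ * 1 := by
        gcongr
        exact hf x
    _ ≤ ε * N := by
        rw [div_lt_iff₀ hε] at hN₀
        have : (N₀ : ℝ) ≤ N := by exact_mod_cast hN
        nlinarith

/-- Induction on a bound m for the support of the frequency. If `A` fixes u, the character is an
eigenfunction and its averages are geometric sums. Otherwise its correlations at lag k are constant
multiples of the character of A^k u - u, which is nonzero but has lost its last possible entry, so
the induction hypothesis feeds van der Corput. -/
theorem uniformlyZeroAverages_mFourier {d : ℕ} {A : Matrix (Fin d) (Fin d) ℤ}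
    (hA : IsUpperUnipotent A) {b : UnitAddTorus (Fin d)}
    (hT : Ergodic (skewTranslation A b) volume) {u : Fin d → ℤ} (hu : u ≠ 0) :
    UniformlyZeroAverages (skewTranslation A b) (mFourier u) := by
  suffices H : ∀ m : ℕ, ∀ u : Fin d → ℤ, u ≠ 0 → (∀ i : Fin d, m ≤ i → u i = 0) →
      UniformlyZeroAverages (skewTranslation A b) (mFourier u) from
    H d u hu fun i hi => absurd i.2 (not_lt.2 hi)
  intro m
  induction m with
  | zero => exact fun u hu h => absurd (funext fun i => h i (Nat.zero_le _)) hu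
  | succ m ih =>
    intro u hu hsupp
    by_cases hfix : A *ᵥ u = u
    · refine uniformlyZeroAverages_of_eigenfunction (c := mFourier u b) ?_
        (norm_mFourier_apply u b) (fun x => (norm_mFourier_apply u x).le)
        (fun x => by rw [mFourier_skewTranslation, hfix])
      -- With eigenvalue 1 the character would be invariant, hence almost everywhere equal to its
      -- integral 0, although it has modulus 1.
      intro hc
      have hinv : mFourier u ∘ skewTranslation A b = mFourier u := by
        funext x
        rw [Function.comp_apply, mFourier_skewTranslation, hfix, hc, one_mul]
      obtain ⟨k, hk⟩ := hT.ae_eq_const_of_ae_eq_comp_ae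
        (mFourier u).continuous.aestronglyMeasurable (Eventually.of_forall (congrFun hinv))
      have hk0 : k = 0 := by
        have := integral_mFourier hu
        rw [integral_congr_ae hk] at this
        simpa using this
      obtain ⟨x, hx⟩ := hk.exists
      have := norm_mFourier_apply u x
      rw [hx, hk0] at this
      simp at this
    · refine .of_vanDerCorput (fun x => (norm_mFourier_apply u x).le) fun k hk => ?_
      obtain ⟨c, hc⟩ := exists_mFourier_iterate A b u k
      have heq : (fun x => mFourier u ((skewTranslation A b)^[k] x) * star (mFourier u x)) =
          fun x => c * mFourier ((A ^ k) *ᵥ u + -u) x := by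
        funext x
        rw [hc, mFourier_add, mFourier_neg, mul_assoc]
        rfl
      rw [heq]
      refine (ih _ ?_ fun i hi => ?_).const_mul c
      · rw [← sub_eq_add_neg]
        exact sub_ne_zero.2 (hA.pow_mulVec_ne hfix hk)
      · rw [Pi.add_apply, Pi.neg_apply, hA.pow_mulVec_apply (i := i) _ k i le_rfl, add_neg_cancel]
        exact fun j hj => hsupp j (Nat.succ_le_of_lt (hi.trans_lt hj))

/-- Unique ergodicity: the Birkhoff averages of a continuous function along an ergodic
skew-translation converge uniformly to its integral. -/
theorem uniformlyZeroAverages_sub_integral {d : ℕ} {A : Matrix (Fin d) (Fin d) ℤ}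
    (hA : IsUpperUnipotent A) {b : UnitAddTorus (Fin d)}
    (hT : Ergodic (skewTranslation A b) volume) (g : C(UnitAddTorus (Fin d), ℂ)) :
    UniformlyZeroAverages (skewTranslation A b) fun x => g x - ∫ y, g y := by
  have hint : ∀ g : C(UnitAddTorus (Fin d), ℂ), Integrable g := fun g =>
    g.continuous.integrable_of_hasCompactSupport (.of_compactSpace _)
  -- The functions with the desired property form a closed subspace containing all characters, whose
  -- span is dense.
  let S : Submodule ℂ C(UnitAddTorus (Fin d), ℂ) :=
    { carrier := {g | UniformlyZeroAverages (skewTranslation A b) fun x => g x - ∫ y, g y}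
      add_mem' := fun {f g} hf hg => by
        have e : (fun x => (f + g) x - ∫ y, (f + g) y) =
            (fun x => f x - ∫ y, f y) + fun x => g x - ∫ y, g y := by
          funext x
          simp only [Pi.add_apply, ContinuousMap.add_apply, integral_add (hint f) (hint g)]
          ring
        rw [Set.mem_ofPred_eq, e]
        exact UniformlyZeroAverages.add hf hg
      zero_mem' := fun ε hε => ⟨0, fun N _ x => by
        simp only [birkhoffSum, ContinuousMap.zero_apply, integral_zero, sub_zero,
          Finset.sum_const_zero, norm_zero]
        positivity⟩
      smul_mem' := fun c g hg => by
        have e : (fun x => (c • g) x - ∫ y, (c • g) y) = fun x => c * (g x - ∫ y, g y) := by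
          funext x
          simp only [ContinuousMap.smul_apply, smul_eq_mul, integral_const_mul]
          ring
        rw [Set.mem_ofPred_eq, e]
        exact UniformlyZeroAverages.const_mul hg c }
  have hclosed : IsClosed (S : Set C(UnitAddTorus (Fin d), ℂ)) := by
    refine isClosed_of_closure_subset fun f hf => ?_
    refine UniformlyZeroAverages.of_approx fun ε hε => ?_
    obtain ⟨g, hg, hfg⟩ := Metric.mem_closure_iff.1 hf (ε / 2) (by positivity)
    refine ⟨_, hg, fun x => ?_⟩
    have hpt : ∀ x, ‖f x - g x‖ ≤ ε / 2 := fun x => by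
      rw [← dist_eq_norm]
      exact (ContinuousMap.dist_apply_le_dist x).trans hfg.le
    have hI : ‖(∫ y, f y) - ∫ y, g y‖ ≤ ε / 2 := by
      rw [← integral_sub (hint f) (hint g)]
      simpa using norm_integral_le_of_norm_le_const (μ := (volume : Measure (UnitAddTorus (Fin d))))
        (Eventually.of_forall hpt)
    calc ‖f x - (∫ y, f y) - (g x - ∫ y, g y)‖ = ‖(f x - g x) - ((∫ y, f y) - ∫ y, g y)‖ := by
          congr 1
          ring
      _ ≤ ε := (norm_sub_le _ _).trans (by linarith [hpt x])
  have hspan : Submodule.span ℂ (Set.range (mFourier (d := Fin d))) ≤ S := by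
    rw [Submodule.span_le]
    rintro _ ⟨u, rfl⟩
    change UniformlyZeroAverages _ _
    by_cases hu : u = 0
    · intro ε hε
      exact ⟨0, fun N _ x => by simp [birkhoffSum, hu, mFourier_zero]; positivity⟩
    · simpa [integral_mFourier hu] using uniformlyZeroAverages_mFourier hA hT hu
  have := Submodule.topologicalClosure_minimal _ hspan hclosed
  rw [span_mFourier_closure_eq_top] at this
  exact this (Submodule.mem_top (x := g))

theorem uniformlyZeroAverages_of_integral_eq_zero {d : ℕ} {A : Matrix (Fin d) (Fin d) ℤ}
    (hA : IsUpperUnipotent A) {b : UnitAddTorus (Fin d)}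
    (hT : Ergodic (skewTranslation A b) volume) {g : UnitAddTorus (Fin d) → ℝ} (hg : Continuous g)
    (h0 : ∫ y, g y = 0) : UniformlyZeroAverages (skewTranslation A b) g := by
  have h := uniformlyZeroAverages_sub_integral hA hT ⟨fun x => (g x : ℂ), by fun_prop⟩
  intro ε hε
  obtain ⟨N₀, hN₀⟩ := h ε hε
  refine ⟨N₀, fun N hN x => ?_⟩
  have := hN₀ N hN x
  unfold birkhoffSum at this ⊢
  have hI : ∫ y, (g y : ℂ) = 0 := by rw [integral_complex_ofReal, h0, Complex.ofReal_zero]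
  simp only [ContinuousMap.coe_mk, hI, sub_zero] at this
  rw [← Complex.norm_real]
  push_cast
  exact this

end Characters

/-! ### Smooth functions on the torus through their periodic lifts -/

section Lift

/-- The covering map `ℝ^d → 𝕋^d`. -/
def toTorus {d : ℕ} (y : Fin d → ℝ) : UnitAddTorus (Fin d) := fun i => (y i : UnitAddCircle)

theorem toTorus_add {d : ℕ} (y z : Fin d → ℝ) : toTorus (y + z) = toTorus y + toTorus z := by
  ext i
  simp [toTorus]

theorem isOpenQuotientMap_toTorus {d : ℕ} :
    IsOpenQuotientMap (toTorus : (Fin d → ℝ) → UnitAddTorus (Fin d)) :=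
  IsOpenQuotientMap.piMap fun _ => QuotientAddGroup.isOpenQuotientMap_mk

theorem toTorus_intCast {d : ℕ} (m : Fin d → ℤ) : toTorus (fun i => (m i : ℝ)) = 0 := by
  ext i
  have := AddCircle.coe_zsmul (p := (1 : ℝ)) (n := m i) (x := 1)
  rw [AddCircle.coe_period, smul_zero, zsmul_eq_mul, mul_one] at this
  exact this

theorem TorusSmooth.continuous {d : ℕ} {f : UnitAddTorus (Fin d) → ℝ} (hf : TorusSmooth f) :
    Continuous f :=
  isOpenQuotientMap_toTorus.isQuotientMap.continuous_iff.2 (ContDiff.continuous hf)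

theorem bounded_of_continuous_of_periodic {d : ℕ} {f : (Fin d → ℝ) → ℝ} (hf : Continuous f)
    (hper : ∀ (m : Fin d → ℤ) y, f (y + fun i => (m i : ℝ)) = f y) : ∃ K, 0 ≤ K ∧ ∀ y, |f y| ≤ K := by
  obtain ⟨K, hK⟩ := (isCompact_Icc (a := (0 : Fin d → ℝ)) (b := 1)).exists_bound_of_continuousOn
    hf.continuousOn
  refine ⟨max K 0, le_max_right _ _, fun y => ?_⟩
  have : y = (fun i => Int.fract (y i)) + fun i => ((⌊y i⌋ : ℤ) : ℝ) := by
    ext i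
    simp
  rw [this, hper]
  exact (hK _ ⟨fun i => Int.fract_nonneg _, fun i => (Int.fract_lt_one _).le⟩).trans
    (le_max_left _ _)

/-- The mean value inequality applied twice: to φ', and to φ minus its linear part on the interval
from 0 to τ. -/
theorem abs_taylor_one_le {φ φ' φ'' : ℝ → ℝ} {K : ℝ} (h1 : ∀ s, HasDerivAt φ (φ' s) s)
    (h2 : ∀ s, HasDerivAt φ' (φ'' s) s) (hK : ∀ s, |φ'' s| ≤ K) (τ : ℝ) :
    |φ τ - φ 0 - τ * φ' 0| ≤ K * |τ| * |τ| := by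
  have hlip : ∀ s, |φ' s - φ' 0| ≤ K * |s| := fun s => by
    simpa using convex_univ.norm_image_sub_le_of_norm_hasDerivWithin_le
      (fun x _ => (h2 x).hasDerivWithinAt) (fun x _ => hK x) (Set.mem_univ 0) (Set.mem_univ s)
  have hK0 : 0 ≤ K := (abs_nonneg _).trans (hK 0)
  have hd : ∀ s, HasDerivAt (fun s => φ s - s * φ' 0) (φ' s - φ' 0) s := fun s => by
    simpa using (h1 s).fun_sub ((hasDerivAt_id s).mul_const (φ' 0))
  have hb : ∀ s ∈ Set.uIcc 0 τ, ‖φ' s - φ' 0‖ ≤ K * |τ| := fun s hs => by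
    refine (hlip s).trans (mul_le_mul_of_nonneg_left ?_ hK0)
    simpa using Set.abs_sub_left_of_mem_uIcc hs
  have := (convex_uIcc 0 τ).norm_image_sub_le_of_norm_hasDerivWithin_le
    (fun x _ => (hd x).hasDerivWithinAt) hb Set.left_mem_uIcc Set.right_mem_uIcc
  simp only [zero_mul, sub_zero, Real.norm_eq_abs] at this
  convert this using 2
  ring

/-- Both increments are compared with τ or σ times the same directional derivative, the second
derivative along v being bounded by periodicity. A difference quotient of fixed step σ thus replaces
the derivative, and its mean vanishes simply by translation invariance. -/
theorem TorusSmooth.exists_abs_sub_difference_quotient_le {d : ℕ} {f : UnitAddTorus (Fin d) → ℝ}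
    (hf : TorusSmooth f) (v : Fin d → ℝ) :
    ∃ K, 0 ≤ K ∧ ∀ y τ σ, σ ≠ 0 → |f (y + toTorus (τ • v)) - f y -
      τ / σ * (f (y + toTorus (σ • v)) - f y)| ≤ K * |τ| * (|τ| + |σ|) := by
  set Φ : (Fin d → ℝ) → ℝ := fun y => f (toTorus y) with hΦ
  have hΦs : ContDiff ℝ (⊤ : ℕ∞) Φ := hf
  set D₁ : (Fin d → ℝ) → ℝ := fun y => fderiv ℝ Φ y v with hD₁
  have hD₁s : ContDiff ℝ (⊤ : ℕ∞) D₁ :=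
    (hΦs.fderiv_right (m := (⊤ : ℕ∞)) le_rfl).clm_apply contDiff_const
  set D₂ : (Fin d → ℝ) → ℝ := fun y => fderiv ℝ D₁ y v with hD₂
  have hD₂s : ContDiff ℝ (⊤ : ℕ∞) D₂ :=
    (hD₁s.fderiv_right (m := (⊤ : ℕ∞)) le_rfl).clm_apply contDiff_const
  have per0 : ∀ (m : Fin d → ℤ) y, Φ (y + fun i => (m i : ℝ)) = Φ y := fun m y => by
    simp only [hΦ, toTorus_add, toTorus_intCast, add_zero]
  have per1 : ∀ (m : Fin d → ℤ) y, D₁ (y + fun i => (m i : ℝ)) = D₁ y := fun m y => by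
    simp only [hD₁]
    rw [← fderiv_comp_add_right, funext (per0 m)]
  have per2 : ∀ (m : Fin d → ℤ) y, D₂ (y + fun i => (m i : ℝ)) = D₂ y := fun m y => by
    simp only [hD₂]
    rw [← fderiv_comp_add_right, funext (per1 m)]
  obtain ⟨K, hK0, hK⟩ := bounded_of_continuous_of_periodic hD₂s.continuous per2
  have hder : ∀ {F : (Fin d → ℝ) → ℝ}, ContDiff ℝ (⊤ : ℕ∞) F → ∀ y s,
      HasDerivAt (fun s : ℝ => F (y + s • v)) (fderiv ℝ F (y + s • v) v) s := fun hF y s => by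
    have hl : HasDerivAt (fun s : ℝ => y + s • v) v s := by
      simpa using ((hasDerivAt_id s).smul_const v).const_add y
    exact ((hF.differentiable (by simp)) (y + s • v)).hasFDerivAt.comp_hasDerivAt s hl
  refine ⟨K, hK0, fun y τ σ hσ => ?_⟩
  obtain ⟨y, rfl⟩ := isOpenQuotientMap_toTorus.surjective y
  have htay : ∀ τ, |Φ (y + τ • v) - Φ y - τ * D₁ y| ≤ K * |τ| * |τ| := fun τ => by
    simpa using abs_taylor_one_le (φ := fun s => Φ (y + s • v)) (φ' := fun s => D₁ (y + s • v))
      (φ'' := fun s => D₂ (y + s • v)) (hder hΦs y) (hder hD₁s y) (fun s => hK _) τ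
  simp only [← toTorus_add]
  change |Φ (y + τ • v) - Φ y - τ / σ * (Φ (y + σ • v) - Φ y)| ≤ _
  have hσ' : 0 < |σ| := abs_pos.2 hσ
  have e : Φ (y + τ • v) - Φ y - τ / σ * (Φ (y + σ • v) - Φ y) =
      (Φ (y + τ • v) - Φ y - τ * D₁ y) - τ / σ * (Φ (y + σ • v) - Φ y - σ * D₁ y) := by
    field_simp
    ring
  rw [e]
  refine (abs_sub _ _).trans ?_
  rw [abs_mul, abs_div]
  calc _ ≤ K * |τ| * |τ| + |τ| / |σ| * (K * |σ| * |σ|) := by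
        gcongr
        · exact htay τ
        · exact htay σ
    _ = _ := by field_simp

end Lift

/-! ### The shear: linear drift along the fibre with negligible change of the roof sums -/

section Shear

/-- Over an ergodic skew-translation, the Birkhoff sum of the increments of a smooth function under
a translation of size `O(1/N)` tends to zero uniformly. -/
theorem TorusSmooth.exists_abs_sum_increments_le {d : ℕ} {A : Matrix (Fin d) (Fin d) ℤ}
    (hA : IsUpperUnipotent A) {b : UnitAddTorus (Fin d)}
    (hT : Ergodic (skewTranslation A b) volume) {f : UnitAddTorus (Fin d) → ℝ}
    (hf : TorusSmooth f) (v : Fin d → ℝ) {ε : ℝ} (hε : 0 < ε) :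
    ∃ N₀ : ℕ, ∀ N, N₀ ≤ N → ∀ τ : ℝ, |τ| * N ≤ 1 → ∀ y,
      |∑ j ∈ Finset.range N, (f ((skewTranslation A b)^[j] y + toTorus (τ • v)) -
        f ((skewTranslation A b)^[j] y))| ≤ ε := by
  obtain ⟨K, hK0, hK⟩ := hf.exists_abs_sub_difference_quotient_le v
  -- The step σ is fixed before N. The replacement error is at most (|τ|N)(K|τ| + Kσ), and each of
  -- Kσ and K|τ| is kept below ε/4.
  obtain ⟨σ, hσ0, hσ⟩ : ∃ σ : ℝ, 0 < σ ∧ K * σ ≤ ε / 4 :=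
    ⟨ε / 4 / (K + 1), by positivity, by
      rw [mul_div_assoc', div_le_iff₀ (by positivity)]
      nlinarith⟩
  set g : UnitAddTorus (Fin d) → ℝ := fun y => f (y + toTorus (σ • v)) - f y with hg
  have hfc := hf.continuous
  have hgc : Continuous g := by
    simp only [hg]
    fun_prop
  have hfi : Integrable f := hfc.integrable_of_hasCompactSupport (.of_compactSpace _)
  have hg0 : ∫ y, g y = 0 := by
    simp only [hg]
    rw [integral_sub (hfi.comp_add_right _) hfi, integral_add_right_eq_self f, sub_self]
  -- The factor σ cancels the denominator of τ/σ, leaving (|τ|N)ε/2.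
  obtain ⟨N₁, hN₁⟩ := uniformlyZeroAverages_of_integral_eq_zero hA hT hgc hg0 (ε * σ / 2)
    (by positivity)
  obtain ⟨N₂, hN₂⟩ := exists_nat_gt (K / (ε / 4))
  refine ⟨max N₁ (max N₂ 1), fun N hN τ hτ y => ?_⟩
  have h1 := hN₁ N ((le_max_left _ _).trans hN) y
  have h2 : K ≤ ε / 4 * N := by
    rw [div_lt_iff₀ (by positivity)] at hN₂
    have : (N₂ : ℝ) ≤ N := by
      exact_mod_cast (le_max_left _ _).trans ((le_max_right _ _).trans hN)
    nlinarith
  have hNpos : (0 : ℝ) < N := by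
    have : 1 ≤ N := (le_max_right _ _).trans ((le_max_right _ _).trans hN)
    exact_mod_cast this
  set T := skewTranslation A b
  have e : ∑ j ∈ Finset.range N, (f (T^[j] y + toTorus (τ • v)) - f (T^[j] y)) =
      ∑ j ∈ Finset.range N, (f (T^[j] y + toTorus (τ • v)) - f (T^[j] y) - τ / σ * g (T^[j] y)) +
        τ / σ * birkhoffSum T g N y := by
    simp only [Finset.sum_sub_distrib, Finset.mul_sum, birkhoffSum]
    ring
  rw [e]
  refine (abs_add_le _ _).trans ?_
  have hA1 : |∑ j ∈ Finset.range N,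
      (f (T^[j] y + toTorus (τ • v)) - f (T^[j] y) - τ / σ * g (T^[j] y))| ≤
        N * (K * |τ| * (|τ| + σ)) := by
    refine (Finset.abs_sum_le_sum_abs _ _).trans ?_
    refine (Finset.sum_le_sum fun j _ => hK (T^[j] y) τ σ hσ0.ne').trans (le_of_eq ?_)
    simp [abs_of_pos hσ0]
  have hA2 : |τ / σ * birkhoffSum T g N y| ≤ ε / 2 := by
    rw [abs_mul, abs_div, abs_of_pos hσ0]
    rw [Real.norm_eq_abs] at h1
    calc |τ| / σ * |birkhoffSum T g N y| ≤ |τ| / σ * (ε * σ / 2 * N) := by gcongr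
      _ = (|τ| * N) * (ε / 2) := by field_simp
      _ ≤ 1 * (ε / 2) := by gcongr
      _ = ε / 2 := one_mul _
  have hA3 : N * (K * |τ| * (|τ| + σ)) ≤ ε / 2 := by
    have hKτ : K * |τ| ≤ ε / 4 := by
      calc K * |τ| ≤ ε / 4 * N * |τ| := by gcongr
        _ = ε / 4 * (|τ| * N) := by ring
        _ ≤ ε / 4 * 1 := by gcongr
        _ = ε / 4 := mul_one _
    calc N * (K * |τ| * (|τ| + σ)) = (|τ| * N) * (K * |τ| + K * σ) := by ring
      _ ≤ 1 * (ε / 4 + ε / 4) := by gcongr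
      _ = ε / 2 := by ring
  linarith

theorem skewTranslation_add_toTorus {n : ℕ} {A : Matrix (Fin (n + 1)) (Fin (n + 1)) ℤ}
    {v : Fin (n + 1) → ℤ} {a : ℤ} (hv : v ᵥ* A = v + a • Pi.single (Fin.last n) 1)
    (b x : UnitAddTorus (Fin (n + 1))) (τ : ℝ) :
    skewTranslation A b (x + toTorus (τ • fun i => (v i : ℝ))) =
      skewTranslation A b x + toTorus (τ • fun i => (v i : ℝ)) +
        Pi.single (Fin.last n) ((τ * a : ℝ) : UnitAddCircle) := by
  ext j
  have hj := congrFun hv j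
  simp only [Matrix.vecMul, dotProduct, Pi.add_apply, Pi.smul_apply, smul_eq_mul] at hj
  have hsum : ∑ i, A i j • toTorus (τ • fun i => (v i : ℝ)) i =
      ((τ * ((∑ i, v i * A i j : ℤ) : ℝ) : ℝ) : UnitAddCircle) := by
    simp only [toTorus, ← AddCircle.coe_zsmul, zsmul_eq_mul, Pi.smul_apply, smul_eq_mul]
    push_cast
    rw [Finset.mul_sum]
    refine Eq.trans (Finset.sum_congr rfl fun i _ => ?_)
      (map_sum (QuotientAddGroup.mk' (AddSubgroup.zmultiples (1 : ℝ)))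
        (fun i => τ * ((v i : ℝ) * (A i j : ℝ))) Finset.univ).symm
    rw [mul_left_comm, mul_comm (A i j : ℝ), ← mul_assoc, mul_assoc]
    rfl
  have e : skewTranslation A b (x + toTorus (τ • fun i => (v i : ℝ))) j =
      skewTranslation A b x j + ∑ i, A i j • toTorus (τ • fun i => (v i : ℝ)) i := by
    simp only [skewTranslation, Pi.add_apply, smul_add, Finset.sum_add_distrib]
    abel
  rw [e, hsum, hj]
  simp only [Pi.add_apply, add_assoc]
  congr 1
  by_cases h : j = Fin.last n
  · subst h
    simp [toTorus, mul_add]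
  · simp [h, toTorus]

/-- The last row of `A` is e_d, so the map commutes with rotations of the fibre; this is why the
drift accumulates linearly. -/
theorem skewTranslation_add_single_last {n : ℕ} {A : Matrix (Fin (n + 1)) (Fin (n + 1)) ℤ}
    (hA : IsUpperUnipotent A) (b x : UnitAddTorus (Fin (n + 1))) (w : UnitAddCircle) :
    skewTranslation A b (x + Pi.single (Fin.last n) w) =
      skewTranslation A b x + Pi.single (Fin.last n) w := by
  ext j
  have hsum : ∑ i, A i j • (Pi.single (Fin.last n) w : UnitAddTorus (Fin (n + 1))) i =
      (Pi.single (Fin.last n) w : UnitAddTorus (Fin (n + 1))) j := by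
    rw [Finset.sum_eq_single (Fin.last n) (fun i _ hi => by simp [hi]) (by simp)]
    by_cases h : j = Fin.last n
    · subst h
      simp [hA.2]
    · rw [hA.1 _ _ (Fin.lt_last_iff_ne_last.2 h)]
      simp [h]
  simp only [skewTranslation, Pi.add_apply, smul_add, Finset.sum_add_distrib, hsum]
  abel

theorem iterate_skewTranslation_add_toTorus {n : ℕ} {A : Matrix (Fin (n + 1)) (Fin (n + 1)) ℤ}
    (hA : IsUpperUnipotent A) {v : Fin (n + 1) → ℤ} {a : ℤ}
    (hv : v ᵥ* A = v + a • Pi.single (Fin.last n) 1)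
    (b x : UnitAddTorus (Fin (n + 1))) (τ : ℝ) (k : ℕ) :
    (skewTranslation A b)^[k] (x + toTorus (τ • fun i => (v i : ℝ))) =
      (skewTranslation A b)^[k] x + toTorus (τ • fun i => (v i : ℝ)) +
        Pi.single (Fin.last n) ((τ * a * k : ℝ) : UnitAddCircle) := by
  induction k with
  | zero => simp
  | succ k ih =>
    rw [Function.iterate_succ_apply', ih, skewTranslation_add_single_last hA,
      skewTranslation_add_toTorus hv, Function.iterate_succ_apply', add_assoc _ (Pi.single _ _),
      ← Pi.single_add, ← AddCircle.coe_add]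
    congr 4
    push_cast
    ring

end Shear

/-! ### Suspension flows: fundamental domain, measurable section, invariant measure -/

section SuspensionTheory

variable {X : Type*}

/-- The generator `(x, r) ↦ (T x, r - Ψ x)` of the equivalence relation defining the suspension. -/
def roofShift (T : X → X) (Ψ : X → ℝ) : X × ℝ → X × ℝ := fun p => (T p.1, p.2 - Ψ p.1)

/-- Vertical translation of `X × ℝ`. -/
def vertical (t : ℝ) : X × ℝ → X × ℝ := fun p => (p.1, p.2 + t)

theorem roofShift_iterate (T : X → X) (Ψ : X → ℝ) (n : ℕ) (p : X × ℝ) :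
    (roofShift T Ψ)^[n] p = (T^[n] p.1, p.2 - birkhoffSum T Ψ n p.1) := by
  induction n with
  | zero => simp
  | succ n ih =>
    rw [Function.iterate_succ_apply', ih, Function.iterate_succ_apply', birkhoffSum_succ, roofShift]
    ext
    · rfl
    · simp only
      ring

theorem roofShift_iterate_vertical (T : X → X) (Ψ : X → ℝ) (n : ℕ) (t : ℝ) (p : X × ℝ) :
    (roofShift T Ψ)^[n] (vertical t p) = vertical t ((roofShift T Ψ)^[n] p) := by
  simp only [roofShift_iterate, vertical]
  ext
  · rfl
  · simp only
    ring

theorem vertical_injective (t : ℝ) : Function.Injective (vertical t : X × ℝ → X × ℝ) := by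
  rintro ⟨x, r⟩ ⟨y, s⟩ h
  simp only [vertical, Prod.mk.injEq, add_left_inj] at h
  exact Prod.ext h.1 h.2

theorem suspension_mk_iterate (T : X → X) (Ψ : X → ℝ) (n : ℕ) (p : X × ℝ) :
    (Quotient.mk (suspensionSetoid T Ψ) ((roofShift T Ψ)^[n] p)) =
      Quotient.mk (suspensionSetoid T Ψ) p := by
  induction n generalizing p with
  | zero => rfl
  | succ n ih =>
    rw [Function.iterate_succ_apply, ih]
    refine (Quotient.sound ?_).symm
    have := SuspensionRel.glue (T := T) (Ψ := Ψ) p.1 (p.2 - Ψ p.1)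
    rw [sub_add_cancel] at this
    exact Relation.EqvGen.rel _ _ this

/-- Equivalence amounts to merging of forward orbits under the single map `roofShift T Ψ`.
Transitivity holds because iterates of one map commute. -/
theorem suspension_mk_eq_iff (T : X → X) (Ψ : X → ℝ) (p q : X × ℝ) :
    Quotient.mk (suspensionSetoid T Ψ) p = Quotient.mk (suspensionSetoid T Ψ) q ↔
      ∃ n m : ℕ, (roofShift T Ψ)^[n] p = (roofShift T Ψ)^[m] q := by
  constructor
  · intro h
    have h' : Relation.EqvGen (SuspensionRel T Ψ) p q := Quotient.exact h
    clear h
    induction h' with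
    | rel p q h =>
      obtain ⟨x, s⟩ := h
      exact ⟨1, 0, by simp [roofShift]⟩
    | refl p => exact ⟨0, 0, rfl⟩
    | symm p q _ ih =>
      obtain ⟨n, m, h⟩ := ih
      exact ⟨m, n, h.symm⟩
    | trans p q r _ _ ih₁ ih₂ =>
      obtain ⟨n, m, h₁⟩ := ih₁
      obtain ⟨k, l, h₂⟩ := ih₂
      refine ⟨k + n, m + l, ?_⟩
      rw [Function.iterate_add_apply, h₁, ← Function.iterate_add_apply, add_comm k m,
        Function.iterate_add_apply, h₂, ← Function.iterate_add_apply]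
  · rintro ⟨n, m, h⟩
    rw [← suspension_mk_iterate T Ψ n p, h, suspension_mk_iterate]

/-- The sequence is c-separated, so its first and last visits to an interval of length 2L differ by
at most 2L/c in index. -/
theorem card_filter_abs_sub_le {s : ℕ → ℝ} {c : ℝ} (hc : 0 < c) (hs : ∀ n, s n + c ≤ s (n + 1))
    (ρ L : ℝ) (hL : 0 ≤ L) (N : ℕ) :
    (((Finset.range N).filter fun n => |ρ - s n| ≤ L).card : ℝ) ≤ 2 * L / c + 1 := by
  set F := (Finset.range N).filter fun n => |ρ - s n| ≤ L with hF
  have hmono : ∀ a k : ℕ, s a + k * c ≤ s (a + k) := by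
    intro a k
    induction k with
    | zero => simp
    | succ k ih =>
      have := hs (a + k)
      rw [← add_assoc]
      push_cast
      linarith
  rcases F.eq_empty_or_nonempty with h | h
  · rw [h]
    simp only [Finset.card_empty, Nat.cast_zero]
    positivity
  · set a := F.min' h
    set b := F.max' h
    have ha : |ρ - s a| ≤ L := (Finset.mem_filter.1 (F.min'_mem h)).2
    have hb : |ρ - s b| ≤ L := (Finset.mem_filter.1 (F.max'_mem h)).2
    have hab : a ≤ b := F.min'_le _ (F.max'_mem h)
    have hcard : F.card ≤ b - a + 1 := by
      have hsub : F ⊆ Finset.Icc a b := fun x hx =>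
        Finset.mem_Icc.2 ⟨F.min'_le _ hx, F.le_max' _ hx⟩
      refine (Finset.card_le_card hsub).trans ?_
      rw [Nat.card_Icc]
      lia
    have h1 := hmono a (b - a)
    rw [Nat.add_sub_cancel' hab] at h1
    have h2 : ((b - a : ℕ) : ℝ) ≤ 2 * L / c := by
      rw [le_div_iff₀ hc]
      rw [abs_le] at ha hb
      linarith [ha.1, ha.2, hb.1, hb.2]
    calc (F.card : ℝ) ≤ ((b - a + 1 : ℕ) : ℝ) := by exact_mod_cast hcard
      _ ≤ 2 * L / c + 1 := by
        push_cast
        linarith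

theorem suspensionFlow_neg (T : X → X) (Ψ : X → ℝ) (t : ℝ) (m : SuspensionSpace T Ψ) :
    suspensionFlow T Ψ t (suspensionFlow T Ψ (-t) m) = m := by
  obtain ⟨p, rfl⟩ := Quotient.exists_rep m
  simp [suspensionFlow, Quotient.map_mk]

variable [MeasurableSpace X]

theorem measurable_vertical (t : ℝ) : Measurable (vertical t : X × ℝ → X × ℝ) := by
  unfold vertical
  fun_prop

theorem measurableEmbedding_vertical (t : ℝ) :
    MeasurableEmbedding (vertical t : X × ℝ → X × ℝ) := by
  let E : X × ℝ ≃ᵐ X × ℝ :=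
    { toFun := vertical t
      invFun := vertical (-t)
      left_inv := fun p => by simp [vertical]
      right_inv := fun p => by simp [vertical]
      measurable_toFun := measurable_vertical t
      measurable_invFun := measurable_vertical (-t) }
  exact E.measurableEmbedding

theorem measurable_suspension_mk (T : X → X) (Ψ : X → ℝ) :
    Measurable (Quotient.mk (suspensionSetoid T Ψ)) :=
  fun _ hs => measurableSet_quotient.1 hs

theorem measurable_suspensionFlow (T : X → X) (Ψ : X → ℝ) (t : ℝ) :
    Measurable (suspensionFlow T Ψ t) := by
  intro S hS
  rw [measurableSet_quotient] at hS ⊢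
  exact measurable_vertical t hS

/-- A measure preserving automorphism with a measurable roof function bounded away from zero and
infinity. -/
structure IsRoofSystem (μ : Measure X) (T : X → X) (Ψ : X → ℝ) (c C : ℝ) : Prop where
  measurePreserving : MeasurePreserving T μ μ
  exists_equiv : ∃ e : X ≃ᵐ X, ⇑e = T
  measurable_roof : Measurable Ψ
  pos : 0 < c
  le_roof : ∀ x, c ≤ Ψ x
  roof_le : ∀ x, Ψ x ≤ C

namespace IsRoofSystem

variable {μ : Measure X} {T : X → X} {Ψ : X → ℝ} {c C : ℝ}

theorem birkhoffSum_step (h : IsRoofSystem μ T Ψ c C) (x : X) (n : ℕ) :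
    birkhoffSum T Ψ n x + c ≤ birkhoffSum T Ψ (n + 1) x := by
  rw [birkhoffSum_succ]
  linarith [h.le_roof (T^[n] x)]

theorem le_birkhoffSum (h : IsRoofSystem μ T Ψ c C) (x : X) (n : ℕ) :
    n * c ≤ birkhoffSum T Ψ n x := by
  induction n with
  | zero => simp [birkhoffSum]
  | succ n ih =>
    have := h.birkhoffSum_step x n
    push_cast
    linarith

theorem birkhoffSum_le (h : IsRoofSystem μ T Ψ c C) (x : X) (n : ℕ) :
    birkhoffSum T Ψ n x ≤ n * C := by
  induction n with
  | zero => simp [birkhoffSum]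
  | succ n ih =>
    rw [birkhoffSum_succ]
    have := h.roof_le (T^[n] x)
    push_cast
    linarith

theorem measurableEmbedding_roofShift (h : IsRoofSystem μ T Ψ c C) :
    MeasurableEmbedding (roofShift T Ψ) := by
  obtain ⟨e, rfl⟩ := h.exists_equiv
  have hΨ := h.measurable_roof
  let E : X × ℝ ≃ᵐ X × ℝ :=
    { toFun := roofShift e Ψ
      invFun := fun p => (e.symm p.1, p.2 + Ψ (e.symm p.1))
      left_inv := fun p => by simp [roofShift]
      right_inv := fun p => by simp [roofShift]
      measurable_toFun := by
        simp only [Equiv.coe_fn_mk]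
        unfold roofShift
        fun_prop
      measurable_invFun := by
        simp only [Equiv.coe_fn_symm_mk]
        fun_prop }
  exact E.measurableEmbedding

theorem measurableEmbedding_iterate (h : IsRoofSystem μ T Ψ c C) (n : ℕ) :
    MeasurableEmbedding (roofShift T Ψ)^[n] := by
  induction n with
  | zero => exact MeasurableEmbedding.id
  | succ n ih => exact ih.comp h.measurableEmbedding_roofShift

theorem surjective_iterate (h : IsRoofSystem μ T Ψ c C) (n : ℕ) :
    Function.Surjective (roofShift T Ψ)^[n] := by
  refine Function.Surjective.iterate (fun p => ?_) n
  obtain ⟨e, rfl⟩ := h.exists_equiv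
  exact ⟨(e.symm p.1, p.2 + Ψ (e.symm p.1)), by simp [roofShift]⟩

theorem measurePreserving_roofShift [SFinite μ] (h : IsRoofSystem μ T Ψ c C) :
    MeasurePreserving (roofShift T Ψ) (μ.prod volume) (μ.prod volume) := by
  have hΨ := h.measurable_roof
  refine h.measurePreserving.skew_product (g := fun x r => r - Ψ x) (by fun_prop)
    (Eventually.of_forall fun x => ?_)
  exact (measurePreserving_sub_right volume (Ψ x)).map_eq

theorem measurePreserving_iterate_vertical [SFinite μ] (h : IsRoofSystem μ T Ψ c C) (n : ℕ)
    (t : ℝ) : MeasurePreserving (fun p => (roofShift T Ψ)^[n] (vertical t p)) (μ.prod volume)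
      (μ.prod volume) := by
  refine (h.measurePreserving_roofShift.iterate n).comp ?_
  exact (MeasurePreserving.id μ).prod (measurePreserving_add_right volume t)

theorem measurableSet_underRoof (h : IsRoofSystem μ T Ψ c C) : MeasurableSet (underRoof Ψ) :=
  (measurableSet_le measurable_const measurable_snd).inter
    (measurableSet_lt measurable_snd (h.measurable_roof.comp measurable_fst))

/-- Stop one step before the height first becomes negative. The roof is at least c > 0, so this
happens, and not at step 0. -/
theorem exists_iterate_mem_underRoof (h : IsRoofSystem μ T Ψ c C) {p : X × ℝ} (hp : 0 ≤ p.2) :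
    ∃ n, (roofShift T Ψ)^[n] p ∈ underRoof Ψ := by
  have hex : ∃ n, p.2 - birkhoffSum T Ψ n p.1 < 0 := by
    obtain ⟨n, hn⟩ := exists_nat_gt (p.2 / c)
    rw [div_lt_iff₀ h.pos] at hn
    exact ⟨n, by linarith [h.le_birkhoffSum p.1 n]⟩
  classical
  obtain ⟨n, hn⟩ : ∃ n, Nat.find hex = n + 1 := by
    refine Nat.exists_eq_succ_of_ne_zero fun h0 => ?_
    have := Nat.find_spec hex
    rw [h0] at this
    simp only [birkhoffSum, Finset.range_zero, Finset.sum_empty] at this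
    linarith
  have h1 := Nat.find_spec hex
  have h2 := Nat.find_min hex (m := n) (by lia)
  rw [hn, birkhoffSum_succ] at h1
  refine ⟨n, ?_⟩
  rw [roofShift_iterate]
  exact ⟨by simpa using h2, by simp only; linarith⟩

/-- Cancelling injective iterates, p would be a later iterate of q; but a single step from under the
roof already makes the height negative, and further steps lower it. -/
theorem eq_of_iterate_eq (h : IsRoofSystem μ T Ψ c C) {p q : X × ℝ} (hp : p ∈ underRoof Ψ)
    (hq : q ∈ underRoof Ψ) {n m : ℕ}
    (hpq : (roofShift T Ψ)^[n] p = (roofShift T Ψ)^[m] q) : n = m ∧ p = q := by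
  wlog hnm : n ≤ m generalizing p q n m
  · obtain ⟨h1, h2⟩ := this hq hp hpq.symm (le_of_not_ge hnm)
    exact ⟨h1.symm, h2.symm⟩
  obtain ⟨k, rfl⟩ := Nat.exists_eq_add_of_le hnm
  rw [Function.iterate_add_apply] at hpq
  have h1 := (h.measurableEmbedding_iterate n).injective hpq
  rcases k with _ | k
  · exact ⟨rfl, h1⟩
  · exfalso
    rw [roofShift_iterate, birkhoffSum_succ'] at h1
    have h2 := congrArg Prod.snd h1
    simp only at h2
    have h3 := h.le_birkhoffSum (T q.1) k
    have h4 : (0 : ℝ) ≤ k * c := mul_nonneg (Nat.cast_nonneg _) h.pos.le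
    linarith [hp.1, hq.2]

theorem exists_underRoof_rep (h : IsRoofSystem μ T Ψ c C) (m : SuspensionSpace T Ψ) :
    ∃ q ∈ underRoof Ψ, Quotient.mk (suspensionSetoid T Ψ) q = m := by
  obtain ⟨p, rfl⟩ := Quotient.exists_rep m
  obtain ⟨k, hk⟩ := exists_nat_gt (-p.2 / c)
  rw [div_lt_iff₀ h.pos] at hk
  obtain ⟨q, hq⟩ := h.surjective_iterate k p
  have hq0 : 0 ≤ q.2 := by
    have h1 := congrArg Prod.snd hq
    rw [roofShift_iterate] at h1
    simp only at h1
    linarith [h.le_birkhoffSum q.1 k]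
  obtain ⟨n, hn⟩ := h.exists_iterate_mem_underRoof hq0
  refine ⟨_, hn, ?_⟩
  rw [suspension_mk_iterate, ← hq, suspension_mk_iterate]

theorem eq_of_mk_eq (h : IsRoofSystem μ T Ψ c C) {p q : X × ℝ} (hp : p ∈ underRoof Ψ)
    (hq : q ∈ underRoof Ψ)
    (hpq : Quotient.mk (suspensionSetoid T Ψ) p = Quotient.mk (suspensionSetoid T Ψ) q) :
    p = q := by
  obtain ⟨n, m, hnm⟩ := (suspension_mk_eq_iff T Ψ p q).1 hpq
  exact (h.eq_of_iterate_eq hp hq hnm).2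

/-- The region under the roof is the range of a measurable section of the suspension. -/
theorem exists_measurable_section (h : IsRoofSystem μ T Ψ c C) :
    ∃ σ : SuspensionSpace T Ψ → X × ℝ, Measurable σ ∧ (∀ m, σ m ∈ underRoof Ψ) ∧
      (∀ m, Quotient.mk (suspensionSetoid T Ψ) (σ m) = m) ∧
      ∀ p ∈ underRoof Ψ, σ (Quotient.mk (suspensionSetoid T Ψ) p) = p := by
  choose σ hσ hσ' using h.exists_underRoof_rep
  refine ⟨σ, fun S hS => ?_, hσ, hσ', fun p hp => h.eq_of_mk_eq (hσ _) hp (hσ' _)⟩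
  rw [measurableSet_quotient]
  -- Measurability for the quotient σ-algebra concerns the saturation of `S ∩ underRoof Ψ`, a
  -- countable union of images and preimages under measurable embeddings.
  have : Quotient.mk'' ⁻¹' (σ ⁻¹' S) = ⋃ n : ℕ, ⋃ m : ℕ, (roofShift T Ψ)^[n] ⁻¹'
      ((roofShift T Ψ)^[m] '' (S ∩ underRoof Ψ)) := by
    ext p
    simp only [Set.mem_preimage, Set.mem_iUnion, Set.mem_image]
    constructor
    · intro hp
      obtain ⟨n, m, hnm⟩ := (suspension_mk_eq_iff T Ψ p _).1 (hσ' (Quotient.mk'' p)).symm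
      exact ⟨n, m, _, ⟨hp, hσ _⟩, hnm.symm⟩
    · rintro ⟨n, m, q, ⟨hqS, hq⟩, hqp⟩
      have h1 : Quotient.mk (suspensionSetoid T Ψ) p = Quotient.mk (suspensionSetoid T Ψ) q :=
        (suspension_mk_eq_iff T Ψ p q).2 ⟨n, m, hqp.symm⟩
      change σ (Quotient.mk (suspensionSetoid T Ψ) p) ∈ S
      rwa [h1, h.eq_of_mk_eq (hσ _) hq (hσ' _)]
  rw [this]
  exact .iUnion fun n => .iUnion fun m => (h.measurableEmbedding_iterate n).measurable
    ((h.measurableEmbedding_iterate m).measurableSet_image' (hS.inter h.measurableSet_underRoof))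

/-- Membership of a translated point in a saturated set, read off in the region under the roof. -/
theorem indicator_vertical_eq_sum {E : Type*} [AddCommMonoid E] (h : IsRoofSystem μ T Ψ c C)
    {t : ℝ} (ht : 0 ≤ t) {N : ℕ} (hN : t + C ≤ N * c) {p : X × ℝ} (hp : p ∈ underRoof Ψ)
    (Q : Set (SuspensionSpace T Ψ)) (a : E) :
    Set.indicator (Quotient.mk (suspensionSetoid T Ψ) ⁻¹' Q) (fun _ => a) (vertical t p) =
      ∑ n ∈ Finset.range N, Set.indicator (underRoof Ψ ∩ Quotient.mk (suspensionSetoid T Ψ) ⁻¹' Q)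
        (fun _ => a) ((roofShift T Ψ)^[n] (vertical t p)) := by
  classical
  have h0 : 0 ≤ (vertical t p).2 := add_nonneg hp.1 ht
  obtain ⟨n, hn⟩ := h.exists_iterate_mem_underRoof h0
  -- The return at step n forces nc ≤ p.2 + t < C + t ≤ Nc, so the first N steps contain the unique
  -- return.
  have hnN : n < N := by
    have h1 := hn.1
    rw [roofShift_iterate] at h1
    simp only [vertical] at h1
    have h2 := h.le_birkhoffSum p.1 n
    have h3 : (n : ℝ) * c < N * c := by linarith [hp.2, h.roof_le p.1]
    exact_mod_cast lt_of_mul_lt_mul_right h3 h.pos.le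
  rw [Finset.sum_eq_single n]
  · simp only [Set.indicator_apply, Set.mem_inter_iff, hn, true_and, Set.mem_preimage,
      suspension_mk_iterate]
  · intro m _ hmn
    refine Set.indicator_of_notMem (fun hm => hmn ?_) _
    refine (h.eq_of_iterate_eq hn hm.1 (n := m) (m := n) ?_).1
    rw [← Function.iterate_add_apply, ← Function.iterate_add_apply, add_comm]
  · exact fun hn' => absurd (Finset.mem_range.2 hnN) hn'

theorem suspensionMeasure_apply (h : IsRoofSystem μ T Ψ c C) {R : Set (SuspensionSpace T Ψ)}
    (hR : MeasurableSet R) : suspensionMeasure μ T Ψ R = ((μ.prod volume) (underRoof Ψ))⁻¹ *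
      (μ.prod volume) (underRoof Ψ ∩ Quotient.mk (suspensionSetoid T Ψ) ⁻¹' R) := by
  rw [suspensionMeasure, Measure.map_apply (measurable_suspension_mk T Ψ) hR,
    ProbabilityTheory.cond_apply h.measurableSet_underRoof]

section Measure

variable [IsProbabilityMeasure μ]

theorem measure_underRoof_ne_zero (h : IsRoofSystem μ T Ψ c C) :
    (μ.prod volume) (underRoof Ψ) ≠ 0 := by
  have hsub : (Set.univ : Set X) ×ˢ Set.Ico 0 c ⊆ underRoof Ψ := fun p hp =>
    ⟨hp.2.1, hp.2.2.trans_le (h.le_roof _)⟩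
  have h0 : 0 < (μ.prod volume) ((Set.univ : Set X) ×ˢ Set.Ico 0 c) := by
    rw [Measure.prod_prod]
    simp [h.pos]
  exact (h0.trans_le (measure_mono hsub)).ne'

theorem measure_underRoof_ne_top (h : IsRoofSystem μ T Ψ c C) :
    (μ.prod volume) (underRoof Ψ) ≠ ⊤ := by
  have hsub : underRoof Ψ ⊆ (Set.univ : Set X) ×ˢ Set.Ico 0 C := fun p hp =>
    ⟨Set.mem_univ _, hp.1, hp.2.trans_le (h.roof_le _)⟩
  refine ((measure_mono hsub).trans_lt ?_).ne
  rw [Measure.prod_prod]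
  simp

theorem isProbabilityMeasure_suspensionMeasure (h : IsRoofSystem μ T Ψ c C) :
    IsProbabilityMeasure (suspensionMeasure μ T Ψ) := by
  have := ProbabilityTheory.cond_isProbabilityMeasure_of_finite h.measure_underRoof_ne_zero
    h.measure_underRoof_ne_top
  exact Measure.isProbabilityMeasure_map (measurable_suspension_mk T Ψ).aemeasurable

/-- The images of the region under the roof by these measure-preserving embeddings are pairwise
disjoint, so the sum is one integral over their union. The bound depends on neither t nor N. -/
theorem sum_setLIntegral_iterate_le (h : IsRoofSystem μ T Ψ c C) (t : ℝ) (N : ℕ)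
    (f : X × ℝ → ENNReal) :
    ∑ n ∈ Finset.range N, ∫⁻ p in underRoof Ψ, f ((roofShift T Ψ)^[n] (vertical t p))
      ∂(μ.prod volume) ≤ ∫⁻ p, f p ∂(μ.prod volume) := by
  set g : ℕ → X × ℝ → X × ℝ := fun n p => (roofShift T Ψ)^[n] (vertical t p) with hg
  have hemb : ∀ n, MeasurableEmbedding (g n) := fun n =>
    (h.measurableEmbedding_iterate n).comp (measurableEmbedding_vertical t)
  have hmp : ∀ n, MeasurePreserving (g n) (μ.prod volume) (μ.prod volume) := fun n =>
    h.measurePreserving_iterate_vertical n t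
  have hmeas : ∀ n, MeasurableSet (g n '' underRoof Ψ) := fun n =>
    (hemb n).measurableSet_image' h.measurableSet_underRoof
  have hdisj : Pairwise (Function.onFun Disjoint fun n => g n '' underRoof Ψ) := by
    intro n m hnm
    rw [Function.onFun, Set.disjoint_left]
    rintro _ ⟨p, hp, rfl⟩ ⟨q, hq, hqp⟩
    simp only [hg, roofShift_iterate_vertical] at hqp
    exact hnm (h.eq_of_iterate_eq hq hp (vertical_injective t hqp)).1.symm
  have heq : ∀ n, ∫⁻ p in underRoof Ψ, f (g n p) ∂(μ.prod volume) =
      ∫⁻ p in g n '' underRoof Ψ, f p ∂(μ.prod volume) := fun n => by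
    rw [← (hmp n).setLIntegral_comp_emb (hemb n)]
  calc _ = ∑ n ∈ Finset.range N, ∫⁻ p in g n '' underRoof Ψ, f p ∂(μ.prod volume) :=
        Finset.sum_congr rfl fun n _ => heq n
    _ = ∫⁻ p in ⋃ n ∈ Finset.range N, g n '' underRoof Ψ, f p ∂(μ.prod volume) :=
        (lintegral_biUnion_finset (hdisj.set_pairwise _) (fun n _ => hmeas n) f).symm
    _ ≤ _ := setLIntegral_le_lintegral _ _

theorem measurePreserving_suspensionFlow (h : IsRoofSystem μ T Ψ c C) (t : ℝ) :
    MeasurePreserving (suspensionFlow T Ψ t) (suspensionMeasure μ T Ψ)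
      (suspensionMeasure μ T Ψ) := by
  have := h.isProbabilityMeasure_suspensionMeasure
  have hle : ∀ t : ℝ, 0 ≤ t → ∀ Q, MeasurableSet Q →
      suspensionMeasure μ T Ψ (suspensionFlow T Ψ t ⁻¹' Q) ≤ suspensionMeasure μ T Ψ Q := by
    intro t ht Q hQ
    rw [h.suspensionMeasure_apply hQ,
      h.suspensionMeasure_apply (measurable_suspensionFlow T Ψ t hQ)]
    refine mul_le_mul' le_rfl ?_
    obtain ⟨N, hN⟩ := exists_nat_gt ((t + C) / c)
    rw [div_lt_iff₀ h.pos] at hN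
    have hQ' : MeasurableSet (Quotient.mk (suspensionSetoid T Ψ) ⁻¹' Q) :=
      measurable_suspension_mk T Ψ hQ
    have hm : Measurable (vertical t : X × ℝ → X × ℝ) := measurable_vertical t
    calc (μ.prod volume) (underRoof Ψ ∩ vertical t ⁻¹' (Quotient.mk (suspensionSetoid T Ψ) ⁻¹' Q))
        = ∫⁻ p in underRoof Ψ, Set.indicator (Quotient.mk (suspensionSetoid T Ψ) ⁻¹' Q)
            (fun _ => 1) (vertical t p) ∂(μ.prod volume) := by
          have : ∀ p : X × ℝ, Set.indicator (Quotient.mk (suspensionSetoid T Ψ) ⁻¹' Q)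
              (fun _ => (1 : ENNReal)) (vertical t p) = Set.indicator (vertical t ⁻¹'
                (Quotient.mk (suspensionSetoid T Ψ) ⁻¹' Q)) 1 p := fun p => rfl
          simp only [this]
          rw [lintegral_indicator_one (hm hQ'), Measure.restrict_apply (hm hQ'), Set.inter_comm]
      _ = ∫⁻ p in underRoof Ψ, ∑ n ∈ Finset.range N, Set.indicator
            (underRoof Ψ ∩ Quotient.mk (suspensionSetoid T Ψ) ⁻¹' Q) (fun _ => 1)
              ((roofShift T Ψ)^[n] (vertical t p)) ∂(μ.prod volume) :=
          setLIntegral_congr_fun h.measurableSet_underRoof fun p hp =>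
            h.indicator_vertical_eq_sum ht hN.le hp Q 1
      _ = ∑ n ∈ Finset.range N, ∫⁻ p in underRoof Ψ, Set.indicator
            (underRoof Ψ ∩ Quotient.mk (suspensionSetoid T Ψ) ⁻¹' Q) (fun _ => 1)
              ((roofShift T Ψ)^[n] (vertical t p)) ∂(μ.prod volume) := by
          refine lintegral_finsetSum _ fun n _ => ?_
          exact (measurable_const.indicator (h.measurableSet_underRoof.inter hQ')).comp
            ((h.measurableEmbedding_iterate n).measurable.comp hm)
      _ ≤ _ := h.sum_setLIntegral_iterate_le t N _
      _ = _ := lintegral_indicator_one (h.measurableSet_underRoof.inter hQ')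
  -- For a probability measure, the inequality applied to the complement gives the reverse
  -- inequality. Negative times follow by inverting the flow.
  have heq : ∀ t : ℝ, 0 ≤ t → ∀ Q, MeasurableSet Q →
      suspensionMeasure μ T Ψ (suspensionFlow T Ψ t ⁻¹' Q) = suspensionMeasure μ T Ψ Q := by
    intro t ht Q hQ
    refine le_antisymm (hle t ht Q hQ) ?_
    have h1 := hle t ht Qᶜ hQ.compl
    rw [Set.preimage_compl, prob_compl_eq_one_sub hQ,
      prob_compl_eq_one_sub (measurable_suspensionFlow T Ψ t hQ)] at h1
    exact (ENNReal.sub_le_sub_iff_left prob_le_one ENNReal.one_ne_top).1 h1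
  refine ⟨measurable_suspensionFlow T Ψ t, Measure.ext fun Q hQ => ?_⟩
  rw [Measure.map_apply (measurable_suspensionFlow T Ψ t) hQ]
  rcases le_total 0 t with ht | ht
  · exact heq t ht Q hQ
  · rw [← heq (-t) (by linarith) _ (measurable_suspensionFlow T Ψ t hQ), ← Set.preimage_comp]
    congr 1
    have : suspensionFlow T Ψ t ∘ suspensionFlow T Ψ (-t) = id :=
      funext (suspensionFlow_neg T Ψ t)
    rw [this, Set.preimage_id]

end Measure

end IsRoofSystem

end SuspensionTheory

/-! ### Reduction of mixing to a generating π-system -/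

section MixingCriterion

/-- A Dynkin argument. Domination of every `ρ i` by the fixed measure `m` lets the limit pass
through countable disjoint unions by dominated convergence. -/
theorem tendsto_measureReal_of_isPiSystem {Y : Type*} [mY : MeasurableSpace Y] {m : Measure Y}
    [IsProbabilityMeasure m] {ι : Type*} {l : Filter ι} {ρ : ι → Measure Y} {a : ℝ}
    (hρ : ∀ i S, MeasurableSet S → ρ i S ≤ m S)
    (huniv : Tendsto (fun i => (ρ i).real Set.univ) l (𝓝 a)) {𝒞 : Set (Set Y)}
    (hgen : mY = MeasurableSpace.generateFrom 𝒞) (hpi : IsPiSystem 𝒞)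
    (h : ∀ S ∈ 𝒞, Tendsto (fun i => (ρ i).real S) l (𝓝 (a * m.real S)))
    {S : Set Y} (hS : MeasurableSet S) :
    Tendsto (fun i => (ρ i).real S) l (𝓝 (a * m.real S)) := by
  have hfin : ∀ i, IsFiniteMeasure (ρ i) := fun i =>
    ⟨(hρ i _ MeasurableSet.univ).trans_lt (measure_lt_top m _)⟩
  induction S, hS using MeasurableSpace.induction_on_inter hgen hpi with
  | empty => simpa using tendsto_const_nhds
  | basic S hS => exact h S hS
  | compl S hS ih =>
    have h1 : ∀ i, (ρ i).real Sᶜ = (ρ i).real Set.univ - (ρ i).real S := fun i =>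
      measureReal_compl hS
    simp only [h1]
    rw [probReal_compl_eq_one_sub hS, mul_sub, mul_one]
    exact huniv.sub ih
  | iUnion f hd hf ih =>
    have hU : ∀ ρ : Measure Y, IsFiniteMeasure ρ → ρ.real (⋃ k, f k) = ∑' k, ρ.real (f k) :=
      fun ρ _ => by
        simp only [measureReal_def]
        rw [measure_iUnion hd hf, ENNReal.tsum_toReal_eq fun k => measure_ne_top ρ _]
    have h1 := fun i => hU (ρ i) (hfin i)
    have h2 := hU m inferInstance
    have hsum : Summable fun k => m.real (f k) := by
      refine ENNReal.summable_toReal ?_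
      rw [← measure_iUnion hd hf]
      exact measure_ne_top _ _
    simp only [h1]
    rw [h2, ← tsum_mul_left]
    refine tendsto_tsum_of_dominated_convergence hsum ih (Eventually.of_forall fun i k => ?_)
    rw [Real.norm_of_nonneg measureReal_nonneg]
    exact ENNReal.toReal_mono (measure_ne_top _ _) (hρ i _ (hf k))

/-- Mixing of a flow may be checked on a `π`-system generating the `σ`-algebra. -/
theorem IsMixingFlow.of_isPiSystem {Y : Type*} [mY : MeasurableSpace Y] {m : Measure Y}
    [IsProbabilityMeasure m] {φ : ℝ → Y → Y} (hφ : ∀ t, MeasurePreserving (φ t) m m)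
    {𝒞 : Set (Set Y)} (hgen : mY = MeasurableSpace.generateFrom 𝒞) (hpi : IsPiSystem 𝒞)
    (h : ∀ R ∈ 𝒞, ∀ Q ∈ 𝒞,
      Tendsto (fun t => m.real (R ∩ φ t ⁻¹' Q)) atTop (𝓝 (m.real R * m.real Q))) :
    IsMixingFlow φ m := by
  have hmeas : ∀ S ∈ 𝒞, MeasurableSet S := fun S hS => by
    rw [hgen]
    exact MeasurableSpace.measurableSet_generateFrom hS
  have hpre : ∀ t {Q}, MeasurableSet Q → m (φ t ⁻¹' Q) = m Q := fun t Q hQ =>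
    (hφ t).measure_preimage hQ.nullMeasurableSet
  -- The two sets are released one at a time: R here, through restrictions of `m`; then Q, through
  -- push-forwards of a restriction, dominated by `m` because the flow preserves it.
  have step : ∀ Q ∈ 𝒞, ∀ R, MeasurableSet R →
      Tendsto (fun t => m.real (R ∩ φ t ⁻¹' Q)) atTop (𝓝 (m.real R * m.real Q)) := by
    intro Q hQ R hR
    have key := tendsto_measureReal_of_isPiSystem (m := m) (l := atTop)
      (ρ := fun t => m.restrict (φ t ⁻¹' Q)) (a := m.real Q) (fun t S _ => Measure.restrict_apply_le _ _)
      ?_ hgen hpi (fun S hS => ?_) hR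
    · rw [mul_comm]
      refine key.congr fun t => ?_
      rw [measureReal_restrict_apply hR]
    · simp only [measureReal_restrict_apply MeasurableSet.univ, Set.univ_inter]
      refine tendsto_const_nhds.congr fun t => ?_
      rw [measureReal_def, measureReal_def, hpre t (hmeas Q hQ)]
    · simp only [measureReal_restrict_apply (hmeas S hS)]
      rw [mul_comm]
      exact h S hS Q hQ
  have step2 : ∀ R, MeasurableSet R → ∀ Q, MeasurableSet Q →
      Tendsto (fun t => m.real (R ∩ φ t ⁻¹' Q)) atTop (𝓝 (m.real R * m.real Q)) := by
    intro R hR Q hQ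
    have hap : ∀ t {S}, MeasurableSet S →
        ((m.restrict R).map (φ t)).real S = m.real (R ∩ φ t ⁻¹' S) := fun t S hS => by
      rw [measureReal_def, Measure.map_apply (hφ t).measurable hS,
        Measure.restrict_apply ((hφ t).measurable hS), Set.inter_comm, measureReal_def]
    have key := tendsto_measureReal_of_isPiSystem (m := m) (l := atTop)
      (ρ := fun t => (m.restrict R).map (φ t)) (a := m.real R) (fun t S hS => ?_) ?_ hgen hpi
      (fun S hS => ?_) hQ
    · exact key.congr fun t => hap t hQ
    · rw [Measure.map_apply (hφ t).measurable hS, ← hpre t hS]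
      exact Measure.restrict_apply_le _ _
    · simp [hap _ MeasurableSet.univ]
    · exact (step S hS R hR).congr fun t => (hap t (hmeas S hS)).symm
  refine ⟨hφ, fun R Q hR hQ => ?_⟩
  have := step2 R hR Q hQ
  rw [← ENNReal.tendsto_toReal_iff (fun t => measure_ne_top _ _)
    (ENNReal.mul_ne_top (measure_ne_top _ _) (measure_ne_top _ _)), ENNReal.toReal_mul]
  exact this

end MixingCriterion

/-! ### Correlations as integrals of orbit sums over X × ℝ -/

section Correlations

variable {X : Type*}

/-- The function `f` is bounded by `M` and vanishes at heights larger than `L`. -/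
def WindowBounded (M L : ℝ) (f : X × ℝ → ℝ) : Prop :=
  ∀ q, |f q| ≤ M ∧ (L < |q.2| → f q = 0)

theorem WindowBounded.sub {M M' L : ℝ} {f g : X × ℝ → ℝ} (hf : WindowBounded M L f)
    (hg : WindowBounded M' L g) : WindowBounded (M + M') L fun q => f q - g q := fun q =>
  ⟨(abs_sub _ _).trans (add_le_add (hf q).1 (hg q).1),
    fun h => by simp only [(hf q).2 h, (hg q).2 h, sub_zero]⟩

theorem WindowBounded.mono {M L L' : ℝ} {f : X × ℝ → ℝ} (hf : WindowBounded M L f) (h : L ≤ L') :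
    WindowBounded M L' f := fun q => ⟨(hf q).1, fun hq => (hf q).2 (h.trans_lt hq)⟩

/-- The sum of `f` along the first `N` identifications of the point `p` translated by `t`. -/
noncomputable def orbitSum (T : X → X) (Ψ : X → ℝ) (N : ℕ) (t : ℝ) (f : X × ℝ → ℝ) (p : X × ℝ) :
    ℝ :=
  ∑ k ∈ Finset.range N, f ((roofShift T Ψ)^[k] (vertical t p))

variable [MeasurableSpace X]

namespace IsRoofSystem

variable {μ : Measure X} {T : X → X} {Ψ : X → ℝ} {c C : ℝ}

theorem measurable_orbitSum (h : IsRoofSystem μ T Ψ c C) (N : ℕ) (t : ℝ) {f : X × ℝ → ℝ}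
    (hf : Measurable f) : Measurable (orbitSum T Ψ N t f) :=
  Finset.measurable_fun_sum _ fun k _ => hf.comp
    ((h.measurableEmbedding_iterate k).measurable.comp (measurable_vertical t))

theorem card_visits_le (h : IsRoofSystem μ T Ψ c C) (N : ℕ) (t : ℝ) {L : ℝ} (hL : 0 ≤ L)
    (p : X × ℝ) : (((Finset.range N).filter
      fun k => |((roofShift T Ψ)^[k] (vertical t p)).2| ≤ L).card : ℝ) ≤ 2 * L / c + 1 := by
  simp only [roofShift_iterate]
  exact card_filter_abs_sub_le h.pos (h.birkhoffSum_step _) _ L hL N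

/-- Only visits to the window of height L contribute, and their number is bounded independently of N
and t. -/
theorem abs_orbitSum_le (h : IsRoofSystem μ T Ψ c C) (N : ℕ) (t : ℝ) {M L : ℝ} (hL : 0 ≤ L)
    {f : X × ℝ → ℝ} (hf : WindowBounded M L f) (p : X × ℝ) :
    |orbitSum T Ψ N t f p| ≤ M * (2 * L / c + 1) := by
  have hM : 0 ≤ M := (abs_nonneg _).trans (hf p).1
  rw [orbitSum, ← Finset.sum_filter_of_ne
    (p := fun k => |((roofShift T Ψ)^[k] (vertical t p)).2| ≤ L)
    (fun k _ hk => not_lt.1 fun hlt => hk ((hf _).2 hlt))]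
  refine (Finset.abs_sum_le_sum_abs _ _).trans ((Finset.sum_le_sum fun k _ => (hf _).1).trans ?_)
  rw [Finset.sum_const, nsmul_eq_mul, mul_comm]
  exact mul_le_mul_of_nonneg_left (h.card_visits_le N t hL p) hM

theorem integrable_mul_orbitSum (h : IsRoofSystem μ T Ψ c C) (N : ℕ) (t : ℝ) {M L : ℝ}
    (hL : 0 ≤ L) {f g : X × ℝ → ℝ} (hf : WindowBounded M L f) (hfm : Measurable f)
    (hg : Integrable g (μ.prod volume)) :
    Integrable (fun p => g p * orbitSum T Ψ N t f p) (μ.prod volume) :=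
  hg.mul_bdd (c := M * (2 * L / c + 1)) (h.measurable_orbitSum N t hfm).aestronglyMeasurable
    (Eventually.of_forall fun p => h.abs_orbitSum_le N t hL hf p)

theorem abs_integral_mul_orbitSum_le (h : IsRoofSystem μ T Ψ c C) (N : ℕ) (t : ℝ) {M L : ℝ}
    (hL : 0 ≤ L) {f g : X × ℝ → ℝ} (hf : WindowBounded M L f)
    (hg : Integrable g (μ.prod volume)) :
    |∫ p, g p * orbitSum T Ψ N t f p ∂(μ.prod volume)| ≤
      (∫ p, |g p| ∂(μ.prod volume)) * (M * (2 * L / c + 1)) := by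
  rw [← integral_mul_const]
  rw [← Real.norm_eq_abs]
  refine norm_integral_le_of_norm_le (hg.abs.mul_const _) (Eventually.of_forall fun p => ?_)
  rw [norm_mul]
  exact mul_le_mul_of_nonneg_left (h.abs_orbitSum_le N t hL hf p) (abs_nonneg _)

/-- Correlations of the suspension flow as integrals over `X × ℝ`. -/
theorem measureReal_inter_preimage_suspensionFlow (h : IsRoofSystem μ T Ψ c C) {t : ℝ}
    (ht : 0 ≤ t) {N : ℕ} (hN : t + C ≤ N * c) {R Q : Set (SuspensionSpace T Ψ)}
    (hR : MeasurableSet R) (hQ : MeasurableSet Q) :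
    (suspensionMeasure μ T Ψ).real (R ∩ suspensionFlow T Ψ t ⁻¹' Q) =
      ((μ.prod volume).real (underRoof Ψ))⁻¹ *
        ∫ p, (underRoof Ψ ∩ Quotient.mk (suspensionSetoid T Ψ) ⁻¹' R).indicator 1 p *
          orbitSum T Ψ N t ((underRoof Ψ ∩ Quotient.mk (suspensionSetoid T Ψ) ⁻¹' Q).indicator
            fun _ => 1) p ∂(μ.prod volume) := by
  have hQt := measurable_suspensionFlow T Ψ t hQ
  have hmk := measurable_suspension_mk T Ψ
  rw [measureReal_def, h.suspensionMeasure_apply (hR.inter hQt), ENNReal.toReal_mul,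
    ENNReal.toReal_inv]
  congr 1
  have hms : MeasurableSet (underRoof Ψ ∩ Quotient.mk (suspensionSetoid T Ψ) ⁻¹'
      (R ∩ suspensionFlow T Ψ t ⁻¹' Q)) :=
    h.measurableSet_underRoof.inter (hmk (hR.inter hQt))
  rw [← measureReal_def, ← integral_indicator_one hms]
  refine integral_congr_ae (Eventually.of_forall fun p => ?_)
  simp only
  by_cases hp : p ∈ underRoof Ψ ∩ Quotient.mk (suspensionSetoid T Ψ) ⁻¹' R
  · rw [Set.indicator_of_mem hp, Pi.one_apply, one_mul, orbitSum,
      ← h.indicator_vertical_eq_sum ht hN hp.1 Q 1]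
    have hiff : p ∈ underRoof Ψ ∩ Quotient.mk (suspensionSetoid T Ψ) ⁻¹'
        (R ∩ suspensionFlow T Ψ t ⁻¹' Q) ↔
        vertical t p ∈ Quotient.mk (suspensionSetoid T Ψ) ⁻¹' Q :=
      ⟨fun hq => hq.2.2, fun hq => ⟨hp.1, hp.2, hq⟩⟩
    classical
    simp only [Set.indicator_apply, hiff, Pi.one_apply]
  · rw [Set.indicator_of_notMem hp, zero_mul]
    exact Set.indicator_of_notMem (fun hq => hp ⟨hq.1, hq.2.1⟩) _

variable [IsProbabilityMeasure μ]

/-- By disjointness of the translated copies of the region under the roof, an error small in L¹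
contributes little, uniformly in N and t. -/
theorem abs_integral_indicator_mul_orbitSum_le (h : IsRoofSystem μ T Ψ c C) (N : ℕ) (t : ℝ)
    {R : Set (X × ℝ)} (hR : R ⊆ underRoof Ψ) {f : X × ℝ → ℝ} (hf : Measurable f) {δ : ℝ}
    (hδ0 : 0 ≤ δ) (hδ : ∫⁻ p, ‖f p‖ₑ ∂(μ.prod volume) ≤ ENNReal.ofReal δ) :
    |∫ p, R.indicator 1 p * orbitSum T Ψ N t f p ∂(μ.prod volume)| ≤ δ := by
  have key : ‖∫ p, R.indicator 1 p * orbitSum T Ψ N t f p ∂(μ.prod volume)‖ₑ ≤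
      ENNReal.ofReal δ := by
    calc _ ≤ ∫⁻ p, ‖R.indicator 1 p * orbitSum T Ψ N t f p‖ₑ ∂(μ.prod volume) :=
          enorm_integral_le_lintegral_enorm _
      _ ≤ ∫⁻ p, (underRoof Ψ).indicator (fun p => ∑ k ∈ Finset.range N,
            ‖f ((roofShift T Ψ)^[k] (vertical t p))‖ₑ) p ∂(μ.prod volume) := by
          refine lintegral_mono fun p => ?_
          by_cases hp : p ∈ R
          · rw [Set.indicator_of_mem hp, Set.indicator_of_mem (hR hp), Pi.one_apply, one_mul]
            exact enorm_sum_le _ _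
          · simp [Set.indicator_of_notMem hp]
      _ = ∑ k ∈ Finset.range N, ∫⁻ p in underRoof Ψ,
            ‖f ((roofShift T Ψ)^[k] (vertical t p))‖ₑ ∂(μ.prod volume) := by
          rw [lintegral_indicator h.measurableSet_underRoof]
          refine lintegral_finsetSum _ fun k _ => ?_
          exact (hf.comp ((h.measurableEmbedding_iterate k).measurable.comp
            (measurable_vertical t))).enorm
      _ ≤ _ := h.sum_setLIntegral_iterate_le t N fun p => ‖f p‖ₑ
      _ ≤ _ := hδ
  rw [← ofReal_norm] at key
  exact (ENNReal.ofReal_le_ofReal_iff hδ0).1 key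

end IsRoofSystem

end Correlations

/-! ### Averaging along the last coordinate -/

section FiberAverage

variable {n : ℕ}

instance UnitAddTorus.instIsAddRightInvariantProdReal :
    ((volume : Measure (UnitAddTorus (Fin n))).prod (volume : Measure ℝ)).IsAddRightInvariant :=
  Measure.prod.instIsAddRightInvariant

instance UnitAddTorus.instRegularProdReal :
    ((volume : Measure (UnitAddTorus (Fin n))).prod (volume : Measure ℝ)).Regular :=
  Measure.Regular.of_sigmaCompactSpace_of_isLocallyFiniteMeasure _

/-- The element of `𝕋^(n+1) × ℝ` whose only nonzero entry is the last coordinate in the torus. -/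
def fiberVec (w : UnitAddCircle) : UnitAddTorus (Fin (n + 1)) × ℝ := (Pi.single (Fin.last n) w, 0)

theorem continuous_fiberVec :
    Continuous (fiberVec : UnitAddCircle → UnitAddTorus (Fin (n + 1)) × ℝ) := by
  unfold fiberVec
  exact (continuous_single (A := fun _ => UnitAddCircle) (Fin.last n)).prodMk continuous_const

/-- The average of a function along the last coordinate of the torus. -/
noncomputable def fiberAverage (f : UnitAddTorus (Fin (n + 1)) × ℝ → ℝ)
    (p : UnitAddTorus (Fin (n + 1)) × ℝ) : ℝ :=
  ∫ w, f (p + fiberVec w)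

theorem measurable_add_fiberVec : Measurable
    fun z : (UnitAddTorus (Fin (n + 1)) × ℝ) × UnitAddCircle => z.1 + fiberVec z.2 :=
  measurable_fst.add (continuous_fiberVec.measurable.comp measurable_snd)

theorem measurable_fiberAverage {f : UnitAddTorus (Fin (n + 1)) × ℝ → ℝ} (hf : Measurable f) :
    Measurable (fiberAverage f) :=
  (StronglyMeasurable.integral_prod_right (f := fun p w => f (p + fiberVec w))
    (hf.comp measurable_add_fiberVec).stronglyMeasurable).measurable

theorem WindowBounded.fiberAverage {M L : ℝ} {f : UnitAddTorus (Fin (n + 1)) × ℝ → ℝ}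
    (hf : WindowBounded M L f) : WindowBounded M L (fiberAverage f) := by
  refine fun q => ⟨?_, fun hq => ?_⟩
  · have := norm_integral_le_of_norm_le_const (μ := (volume : Measure UnitAddCircle))
      (f := fun w => f (q + fiberVec w)) (Eventually.of_forall fun w => (hf _).1)
    simpa [_root_.fiberAverage] using this
  · have : ∀ w, f (q + fiberVec w) = 0 := fun w => (hf _).2 (by simpa [fiberVec] using hq)
    simp [_root_.fiberAverage, this]

theorem WindowBounded.integrable_fiber {M L : ℝ} {f : UnitAddTorus (Fin (n + 1)) × ℝ → ℝ}
    (hf : WindowBounded M L f) (hfm : Measurable f) (p : UnitAddTorus (Fin (n + 1)) × ℝ) :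
    Integrable fun w => f (p + fiberVec w) :=
  .of_bound (hfm.comp (measurable_const.add continuous_fiberVec.measurable)).aestronglyMeasurable M
    (Eventually.of_forall fun _ => (hf _).1)

theorem fiberAverage_sub {M M' L : ℝ} {f g : UnitAddTorus (Fin (n + 1)) × ℝ → ℝ}
    (hf : WindowBounded M L f) (hfm : Measurable f) (hg : WindowBounded M' L g)
    (hgm : Measurable g) (p : UnitAddTorus (Fin (n + 1)) × ℝ) :
    fiberAverage (fun q => f q - g q) p = fiberAverage f p - fiberAverage g p :=
  integral_sub (hf.integrable_fiber hfm p) (hg.integrable_fiber hgm p)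

/-- Fubini and translation invariance: averaging is an L¹ contraction. -/
theorem lintegral_enorm_fiberAverage_le {f : UnitAddTorus (Fin (n + 1)) × ℝ → ℝ}
    (hf : Measurable f) :
    ∫⁻ p, ‖fiberAverage f p‖ₑ ∂(volume.prod volume) ≤ ∫⁻ p, ‖f p‖ₑ ∂(volume.prod volume) := by
  calc ∫⁻ p, ‖fiberAverage f p‖ₑ ∂(volume.prod volume)
      ≤ ∫⁻ p, (∫⁻ w : UnitAddCircle, ‖f (p + fiberVec w)‖ₑ) ∂(volume.prod volume) :=
        lintegral_mono fun p => enorm_integral_le_lintegral_enorm _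
    _ = ∫⁻ w : UnitAddCircle, (∫⁻ p, ‖f (p + fiberVec w)‖ₑ ∂(volume.prod volume)) :=
        lintegral_lintegral_swap (hf.comp measurable_add_fiberVec).enorm.aemeasurable
    _ = ∫⁻ _ : UnitAddCircle, (∫⁻ p, ‖f p‖ₑ ∂(volume.prod volume)) :=
        lintegral_congr fun w => lintegral_add_right_eq_self (fun p => ‖f p‖ₑ) (fiberVec w)
    _ = _ := by simp

end FiberAverage

/-! ### Equidistribution along the fibres, term by term and then summed -/

section Equidistribution

theorem exists_abs_mul_sub_mul_le {Y : Type*} [PseudoMetricSpace Y] {h f : Y → ℝ}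
    (hh : UniformContinuous h) (hf : UniformContinuous f) {M : ℝ} (hhM : ∀ p, |h p| ≤ M)
    (hfM : ∀ p, |f p| ≤ M) (hM : 0 ≤ M) {ε : ℝ} (hε : 0 < ε) :
    ∃ δ, 0 < δ ∧ δ ≤ 1 ∧ ∀ p p' q q', dist p' p < δ → dist q' q < δ →
      |h p' * f q' - h p * f q| ≤ ε := by
  obtain ⟨δ₁, hδ₁, h₁⟩ := Metric.uniformContinuous_iff.1 hh (ε / 2 / (M + 1)) (by positivity)
  obtain ⟨δ₂, hδ₂, h₂⟩ := Metric.uniformContinuous_iff.1 hf (ε / 2 / (M + 1)) (by positivity)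
  refine ⟨min 1 (min δ₁ δ₂), by positivity, min_le_left _ _, fun p p' q q' hp hq => ?_⟩
  have hp' := (h₁ (hp.trans_le ((min_le_right _ _).trans (min_le_left _ _)))).le
  have hq' := (h₂ (hq.trans_le ((min_le_right _ _).trans (min_le_right _ _)))).le
  rw [Real.dist_eq] at hp' hq'
  have e : h p' * f q' - h p * f q = h p' * (f q' - f q) + (h p' - h p) * f q := by ring
  rw [e]
  refine (abs_add_le _ _).trans ?_
  rw [abs_mul, abs_mul]
  calc |h p'| * |f q' - f q| + |h p' - h p| * |f q|
      ≤ (M + 1) * (ε / 2 / (M + 1)) + ε / 2 / (M + 1) * (M + 1) := by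
        gcongr
        · linarith [hhM p']
        · linarith [hfM q]
    _ = ε := by field_simp; ring

variable {n : ℕ} {A : Matrix (Fin (n + 1)) (Fin (n + 1)) ℤ} {b : UnitAddTorus (Fin (n + 1))}
  {ψ : UnitAddTorus (Fin n) → ℝ} {v : Fin (n + 1) → ℤ} {a : ℤ}

theorem torusProj_iterate (hA : IsUpperUnipotent A) (b x : UnitAddTorus (Fin (n + 1))) (k : ℕ) :
    torusProj ((skewTranslation A b)^[k] x) =
      (skewTranslation (dropLast A) (torusProj b))^[k] (torusProj x) :=
  Function.Semiconj.iterate_right (f := torusProj) (torusProj_skewTranslation hA b) k x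

theorem birkhoffSum_add_toTorus_sub (hA : IsUpperUnipotent A)
    (hv : v ᵥ* A = v + a • Pi.single (Fin.last n) 1) (x : UnitAddTorus (Fin (n + 1))) (τ : ℝ)
    (k : ℕ) :
    birkhoffSum (skewTranslation A b) (ψ ∘ torusProj) k (x + toTorus (τ • fun i => (v i : ℝ))) -
      birkhoffSum (skewTranslation A b) (ψ ∘ torusProj) k x =
    ∑ j ∈ Finset.range k,
      (ψ ((skewTranslation (dropLast A) (torusProj b))^[j] (torusProj x) +
          toTorus (τ • fun i : Fin n => (v i.castSucc : ℝ))) -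
        ψ ((skewTranslation (dropLast A) (torusProj b))^[j] (torusProj x))) := by
  rw [birkhoffSum, birkhoffSum, ← Finset.sum_sub_distrib]
  refine Finset.sum_congr rfl fun j _ => ?_
  rw [iterate_skewTranslation_add_toTorus hA hv, Function.comp_apply, Function.comp_apply,
    ← torusProj_iterate hA]
  congr 2
  ext i
  simp [torusProj, toTorus, (Fin.castSucc_lt_last i).ne]

/-- Translating along `v` by `O(1/k)` turns the last coordinate of the `k`-th image by any given
amount, and moves everything else by a small amount only. -/
theorem exists_translation_dist_lt (hA : IsUpperUnipotent A)
    (hT : Ergodic (skewTranslation A b) volume) (hψ : TorusSmooth ψ) (ha : a ≠ 0)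
    (hv : v ᵥ* A = v + a • Pi.single (Fin.last n) 1) {δ : ℝ} (hδ : 0 < δ) :
    ∃ K : ℕ, ∀ k, K ≤ k → ∀ w : UnitAddCircle, ∃ θ : UnitAddTorus (Fin (n + 1)), ∀ t p,
      dist (p + (θ, 0)) p < δ ∧
      dist ((roofShift (skewTranslation A b) (ψ ∘ torusProj))^[k] (vertical t (p + (θ, 0))))
        ((roofShift (skewTranslation A b) (ψ ∘ torusProj))^[k] (vertical t p) + fiberVec w) < δ := by
  obtain ⟨K₁, hK₁⟩ := hψ.exists_abs_sum_increments_le hA.dropLast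
    (ergodic_skewTranslation_dropLast hA hT) (fun i : Fin n => (v i.castSucc : ℝ)) (half_pos hδ)
  have hcont : Continuous fun τ : ℝ => toTorus (τ • fun i => (v i : ℝ)) :=
    isOpenQuotientMap_toTorus.continuous.comp (by fun_prop)
  obtain ⟨η, hη, hηδ⟩ := Metric.continuous_iff.1 hcont 0 δ hδ
  obtain ⟨K₂, hK₂⟩ := exists_nat_gt (1 / η)
  refine ⟨max K₁ (max K₂ 1), fun k hk w => ?_⟩
  obtain ⟨s, hs, rfl⟩ := AddCircle.eq_coe_Ico w
  have hk1 : K₁ ≤ k := (le_max_left _ _).trans hk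
  have hk2 : (K₂ : ℝ) ≤ k := by exact_mod_cast ((le_max_left _ _).trans (le_max_right _ _)).trans hk
  have hk0 : (0 : ℝ) < k := by
    have : 1 ≤ k := ((le_max_right _ _).trans (le_max_right _ _)).trans hk
    exact_mod_cast this
  have ha' : (a : ℝ) ≠ 0 := by exact_mod_cast ha
  have ha1 : (1 : ℝ) ≤ |(a : ℝ)| := by exact_mod_cast Int.one_le_abs ha
  -- Chosen so that τak = s, the lift of w to [0, 1). Since |a| ≥ 1 for a nonzero integer, |τ|k ≤ 1.
  set τ : ℝ := s / (a * k) with hτ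
  have hτk : |τ| * k ≤ 1 := by
    rw [hτ, abs_div, abs_mul, abs_of_nonneg hs.1, abs_of_pos hk0, div_mul_eq_mul_div,
      div_le_one (by positivity)]
    have := hs.2.le
    gcongr
    linarith
  have hτη : |τ| < η := by
    rw [div_lt_iff₀ hη] at hK₂
    by_contra hcon
    have h1 : η * k ≤ |τ| * k := by gcongr; exact not_lt.1 hcon
    nlinarith
  have hθ : dist (toTorus (τ • fun i => (v i : ℝ))) 0 < δ := by
    have := hηδ τ (by simpa [Real.dist_eq] using hτη)
    have h0 : toTorus ((0 : ℝ) • fun i => (v i : ℝ)) = 0 := by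
      ext i
      simp [toTorus]
    rwa [h0] at this
  refine ⟨toTorus (τ • fun i => (v i : ℝ)), fun t p => ⟨?_, ?_⟩⟩
  · rw [Prod.dist_eq]
    refine max_lt ?_ (by simpa using hδ)
    simpa using hθ
  · rw [roofShift_iterate, roofShift_iterate, Prod.dist_eq]
    simp only [vertical, fiberVec, Prod.fst_add, Prod.snd_add, add_zero]
    refine max_lt ?_ ?_
    · rw [iterate_skewTranslation_add_toTorus hA hv]
      have : τ * a * k = s := by
        rw [hτ]
        field_simp
      rw [this, dist_add_right]
      simpa using hθ
    · rw [Real.dist_eq, sub_sub_sub_cancel_left, abs_sub_comm, birkhoffSum_add_toTorus_sub hA hv]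
      exact (hK₁ k hk1 τ hτk _).trans_lt (half_lt_self hδ)

end Equidistribution

section Equidistribution

theorem HasCompactSupport.exists_windowBounded {X : Type*} [TopologicalSpace X] {f : X × ℝ → ℝ}
    (hc : HasCompactSupport f) (hf : Continuous f) : ∃ M L, 0 ≤ L ∧ WindowBounded M L f := by
  obtain ⟨M, hM⟩ := hc.exists_bound_of_continuous hf
  obtain ⟨L, hL⟩ := hc.isCompact.exists_bound_of_continuousOn
    (continuous_snd (X := X) (Y := ℝ)).continuousOn
  refine ⟨M, max L 0, le_max_right _ _, fun q => ⟨hM q, fun hq => ?_⟩⟩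
  by_contra h0
  exact absurd (hL q (subset_tsupport f h0)) (not_le.2 ((le_max_left _ _).trans_lt hq))

theorem uniformContinuous_of_hasCompactSupport {X : Type*} [UniformSpace X] {f : X → ℝ}
    (hc : HasCompactSupport f) (hf : Continuous f) : UniformContinuous f :=
  hf.uniformContinuous_of_tendsto_cocompact hc.is_zero_at_infty

variable {n : ℕ} {A : Matrix (Fin (n + 1)) (Fin (n + 1)) ℤ} {b : UnitAddTorus (Fin (n + 1))}
  {ψ : UnitAddTorus (Fin n) → ℝ} {v : Fin (n + 1) → ℤ} {a : ℤ}

theorem continuous_roofShift_iterate_vertical (A : Matrix (Fin (n + 1)) (Fin (n + 1)) ℤ)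
    (b : UnitAddTorus (Fin (n + 1))) (hψ : Continuous ψ) (k : ℕ) (t : ℝ) :
    Continuous fun p =>
      (roofShift (skewTranslation A b) (ψ ∘ torusProj))^[k] (vertical t p) := by
  have h1 : Continuous (roofShift (skewTranslation A b) (ψ ∘ torusProj)) := by
    have := continuous_skewTranslation A b
    have := continuous_torusProj (n := n)
    unfold roofShift
    fun_prop
  refine (h1.iterate k).comp ?_
  unfold vertical
  fun_prop

/-- A single term of the correlation of a function with a function of zero fiber average is small
relative to the measure of the set where it does not vanish. -/
theorem exists_abs_integral_mul_sub_fiberAverage_le (hA : IsUpperUnipotent A)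
    (hT : Ergodic (skewTranslation A b) volume) (hψ : TorusSmooth ψ) (ha : a ≠ 0)
    (hv : v ᵥ* A = v + a • Pi.single (Fin.last n) 1)
    {h f : UnitAddTorus (Fin (n + 1)) × ℝ → ℝ} (hhc : HasCompactSupport h) (hh : Continuous h)
    (hfc : HasCompactSupport f) (hf : Continuous f) {M L : ℝ} (hhw : WindowBounded M L h)
    (hfw : WindowBounded M L f) {ε : ℝ} (hε : 0 < ε) :
    ∃ K : ℕ, ∀ k, K ≤ k → ∀ t,
      |∫ p, h p * (f ((roofShift (skewTranslation A b) (ψ ∘ torusProj))^[k] (vertical t p)) -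
        fiberAverage f ((roofShift (skewTranslation A b) (ψ ∘ torusProj))^[k] (vertical t p)))
          ∂(volume.prod volume)| ≤
      ε * ((volume : Measure (UnitAddTorus (Fin (n + 1)))).prod (volume : Measure ℝ)).real
        {p | |p.2| ≤ L + 1 ∧ |((roofShift (skewTranslation A b) (ψ ∘ torusProj))^[k]
          (vertical t p)).2| ≤ L + 1} := by
  have hM : 0 ≤ M := (abs_nonneg _).trans (hfw 0).1
  -- The bound δ ≤ 1 is what makes the window L + 1 suffice: perturbed points in the support of f
  -- stay within it.
  obtain ⟨δ, hδ0, hδ1, hδ⟩ := exists_abs_mul_sub_mul_le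
    (uniformContinuous_of_hasCompactSupport hhc hh) (uniformContinuous_of_hasCompactSupport hfc hf)
    (fun p => (hhw p).1) (fun p => (hfw p).1) hM hε
  obtain ⟨K, hK⟩ := exists_translation_dist_lt hA hT hψ ha hv hδ0
  refine ⟨K, fun k hk t => ?_⟩
  set G : UnitAddTorus (Fin (n + 1)) × ℝ → UnitAddTorus (Fin (n + 1)) × ℝ := fun p =>
    (roofShift (skewTranslation A b) (ψ ∘ torusProj))^[k] (vertical t p) with hG
  have hGc : Continuous G := continuous_roofShift_iterate_vertical A b hψ.continuous k t
  set ν := (volume : Measure (UnitAddTorus (Fin (n + 1)))).prod (volume : Measure ℝ) with hν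
  set W : Set (UnitAddTorus (Fin (n + 1)) × ℝ) := {p | |p.2| ≤ L + 1 ∧ |(G p).2| ≤ L + 1} with hW
  have hWm : MeasurableSet W :=
    (measurableSet_le measurable_snd.abs measurable_const).inter
      (measurableSet_le hGc.measurable.snd.abs measurable_const)
  have hWfin : ν W ≠ ⊤ := by
    have hsub : W ⊆ Set.univ ×ˢ Set.Icc (-(L + 1)) (L + 1) := fun p hp =>
      ⟨Set.mem_univ _, abs_le.1 hp.1⟩
    refine ((measure_mono hsub).trans_lt ?_).ne
    rw [hν, Measure.prod_prod]
    simp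
  have hhi : Integrable h ν := hh.integrable_of_hasCompactSupport hhc
  have hint : ∀ g : UnitAddTorus (Fin (n + 1)) × ℝ → ℝ, Continuous g → (∀ p, |g p| ≤ M) →
      Integrable (fun p => h p * g p) ν := fun g hg hb =>
    hhi.mul_bdd (c := M) hg.aestronglyMeasurable (Eventually.of_forall hb)
  -- Changing variables by the small θ adapted to w leaves the first integral unchanged and makes
  -- its integrand close to that of the second.
  have hterm : ∀ w, |∫ p, h p * f (G p) ∂ν - ∫ p, h p * f (G p + fiberVec w) ∂ν| ≤
      ε * ν.real W := by
    intro w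
    obtain ⟨θ, hθ⟩ := hK k hk w
    have hGθ : Continuous fun p => G (p + (θ, 0)) := hGc.comp (by fun_prop)
    have i1 : Integrable (fun p => h (p + (θ, 0)) * f (G (p + (θ, 0)))) ν :=
      (hint _ (hf.comp hGc) fun p => (hfw _).1).comp_add_right (θ, 0)
    have i2 : Integrable (fun p => h p * f (G p + fiberVec w)) ν :=
      hint _ (hf.comp (by fun_prop)) fun p => (hfw _).1
    rw [← integral_add_right_eq_self (fun p => h p * f (G p)) (θ, (0 : ℝ)), ← integral_sub i1 i2,
      mul_comm ε, ← smul_eq_mul, ← integral_indicator_const ε hWm, ← Real.norm_eq_abs]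
    refine norm_integral_le_of_norm_le
      ((integrable_indicator_iff hWm).2 (integrableOn_const hWfin)) (Eventually.of_forall fun p => ?_)
    obtain ⟨hd1, hd2⟩ := hθ t p
    by_cases hp : p ∈ W
    · rw [Set.indicator_of_mem hp]
      exact hδ _ _ _ _ hd1 hd2
    -- Off W both products vanish: either through h, as θ does not change the height, or through f,
    -- as the two image heights differ by less than 1.
    · rw [Set.indicator_of_notMem hp, norm_le_zero_iff]
      by_cases hp2 : |p.2| ≤ L + 1
      · have hg2 : L + 1 < |(G p).2| := not_le.1 fun hle => hp ⟨hp2, hle⟩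
        have hg3 : L < |(G p + fiberVec w).2| := by
          simp only [fiberVec, Prod.snd_add, add_zero]
          linarith
        have hg4 : L < |(G (p + (θ, 0))).2| := by
          have h3 := (Prod.dist_eq (x := G (p + (θ, 0))) (y := G p + fiberVec w)) ▸ hd2
          have h4 := (le_max_right _ _).trans_lt h3
          simp only [fiberVec, Prod.snd_add, add_zero, Real.dist_eq] at h4
          rw [abs_sub_comm] at h4
          have := abs_sub_abs_le_abs_sub (G p).2 (G (p + (θ, 0))).2
          linarith
        rw [(hfw _).2 hg3, (hfw _).2 hg4, mul_zero, mul_zero, sub_zero]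
      · have hp3 : L < |p.2| := by linarith [not_le.1 hp2]
        rw [(hhw p).2 hp3, (hhw (p + (θ, 0))).2 (by simpa using hp3), zero_mul, zero_mul, sub_zero]
  have hprod : Integrable
      (Function.uncurry fun p (w : UnitAddCircle) => h p * f (G p + fiberVec w))
      (ν.prod volume) := by
    have hc : Continuous (Function.uncurry fun p (w : UnitAddCircle) => f (G p + fiberVec w)) :=
      hf.comp ((hGc.comp continuous_fst).add (continuous_fiberVec.comp continuous_snd))
    have := (hhi.comp_fst (volume : Measure UnitAddCircle)).mul_bdd (c := M)
      hc.aestronglyMeasurable (Eventually.of_forall fun z => (hfw _).1)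
    exact this
  have havg : ∫ p, h p * fiberAverage f (G p) ∂ν =
      ∫ w : UnitAddCircle, (∫ p, h p * f (G p + fiberVec w) ∂ν) := by
    rw [← integral_integral_swap hprod]
    refine integral_congr_ae (Eventually.of_forall fun p => ?_)
    simp only [fiberAverage]
    rw [integral_const_mul]
  have hiavg : Integrable (fun p => h p * fiberAverage f (G p)) ν :=
    hhi.mul_bdd (c := M) ((measurable_fiberAverage hf.measurable).comp
      hGc.measurable).aestronglyMeasurable (Eventually.of_forall fun p => (hfw.fiberAverage _).1)
  have hifw : Integrable fun w : UnitAddCircle => ∫ p, h p * f (G p + fiberVec w) ∂ν :=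
    hprod.integral_prod_right
  simp only [mul_sub]
  change |∫ p, (h p * f (G p) - h p * fiberAverage f (G p)) ∂ν| ≤ _
  rw [integral_sub (hint (fun p => f (G p)) (hf.comp hGc) fun p => (hfw _).1) hiavg, havg]
  have hconst : ∫ p, h p * f (G p) ∂ν = ∫ _ : UnitAddCircle, (∫ p, h p * f (G p) ∂ν) := by simp
  rw [hconst, ← integral_sub (integrable_const _) hifw]
  have := norm_integral_le_of_norm_le_const (μ := (volume : Measure UnitAddCircle))
    (f := fun w => ∫ p, h p * f (G p) ∂ν - ∫ p, h p * f (G p + fiberVec w) ∂ν)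
    (Eventually.of_forall hterm)
  rwa [probReal_univ, mul_one] at this

/-- Decorrelation of continuous compactly supported functions from functions of zero fiber
average, uniformly in the number of terms. -/
theorem exists_abs_integral_mul_orbitSum_sub_fiberAverage_le (hA : IsUpperUnipotent A)
    (hT : Ergodic (skewTranslation A b) volume) (hψ : TorusSmooth ψ) (ha : a ≠ 0)
    (hv : v ᵥ* A = v + a • Pi.single (Fin.last n) 1) {c C : ℝ}
    (hS : IsRoofSystem volume (skewTranslation A b) (ψ ∘ torusProj) c C)
    {h f : UnitAddTorus (Fin (n + 1)) × ℝ → ℝ} (hhc : HasCompactSupport h) (hh : Continuous h)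
    (hfc : HasCompactSupport f) (hf : Continuous f) {ε : ℝ} (hε : 0 < ε) :
    ∃ t₀, ∀ t, t₀ ≤ t → ∀ N,
      |∫ p, h p * orbitSum (skewTranslation A b) (ψ ∘ torusProj) N t
        (fun q => f q - fiberAverage f q) p ∂(volume.prod volume)| ≤ ε := by
  obtain ⟨M₁, L₁, hL₁, hhw⟩ := hhc.exists_windowBounded hh
  obtain ⟨M₂, L₂, hL₂, hfw⟩ := hfc.exists_windowBounded hf
  set M := max M₁ M₂
  set L := max L₁ L₂
  have hL : 0 ≤ L := hL₁.trans (le_max_left _ _)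
  replace hhw : WindowBounded M L h := fun q =>
    ⟨(hhw q).1.trans (le_max_left _ _), fun hq => (hhw q).2 ((le_max_left _ _).trans_lt hq)⟩
  replace hfw : WindowBounded M L f := fun q =>
    ⟨(hfw q).1.trans (le_max_right _ _), fun hq => (hfw q).2 ((le_max_right _ _).trans_lt hq)⟩
  have hc := hS.pos
  set B : ℝ := 2 * (L + 1) / c + 1 with hB
  have hB0 : 0 < B := by positivity
  set ε' : ℝ := ε / (B * (2 * (L + 1))) with hε'
  obtain ⟨K, hK⟩ := exists_abs_integral_mul_sub_fiberAverage_le hA hT hψ ha hv hhc hh hfc hf hhw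
    hfw (ε := ε') (by positivity)
  -- Beyond this time the terms k < K vanish: from a height at least -L, k steps leave the height at
  -- least -L + t - KC ≥ L + 1, outside the window of f.
  refine ⟨K * C + 2 * L + 1, fun t ht N => ?_⟩
  set E := roofShift (skewTranslation A b) (ψ ∘ torusProj) with hE
  set ν := (volume : Measure (UnitAddTorus (Fin (n + 1)))).prod (volume : Measure ℝ) with hν
  set g : UnitAddTorus (Fin (n + 1)) × ℝ → ℝ := fun q => f q - fiberAverage f q with hg
  have hgw : WindowBounded (M + M) L g := hfw.sub hfw.fiberAverage
  have hgm : Measurable g := hf.measurable.sub (measurable_fiberAverage hf.measurable)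
  have hGc : ∀ k, Continuous fun p => E^[k] (vertical t p) := fun k =>
    continuous_roofShift_iterate_vertical A b hψ.continuous k t
  have hhi : Integrable h ν := hh.integrable_of_hasCompactSupport hhc
  set W : ℕ → Set (UnitAddTorus (Fin (n + 1)) × ℝ) := fun k =>
    {p | |p.2| ≤ L + 1 ∧ |(E^[k] (vertical t p)).2| ≤ L + 1} with hW
  have hWm : ∀ k, MeasurableSet (W k) := fun k =>
    (measurableSet_le measurable_snd.abs measurable_const).inter
      (measurableSet_le (hGc k).measurable.snd.abs measurable_const)
  set Z : Set (UnitAddTorus (Fin (n + 1)) × ℝ) := Set.univ ×ˢ Set.Icc (-(L + 1)) (L + 1) with hZ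
  have hZm : MeasurableSet Z := MeasurableSet.univ.prod measurableSet_Icc
  have hZν : ν Z = ENNReal.ofReal (2 * (L + 1)) := by
    rw [hν, hZ, Measure.prod_prod]
    simp only [measure_univ, Real.volume_Icc, one_mul]
    congr 1
    ring
  have hZfin : ν Z ≠ ⊤ := by
    rw [hZν]
    exact ENNReal.ofReal_ne_top
  have hWZ : ∀ k, W k ⊆ Z := fun k p hp => ⟨Set.mem_univ _, abs_le.1 hp.1⟩
  have hWfin : ∀ k, ν (W k) ≠ ⊤ := fun k => ((measure_mono (hWZ k)).trans_lt hZfin.lt_top).ne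
  have hterm : ∀ k, |∫ p, h p * g (E^[k] (vertical t p)) ∂ν| ≤ ε' * ν.real (W k) := by
    intro k
    by_cases hk : K ≤ k
    · exact hK k hk t
    · have hz : ∀ p, h p * g (E^[k] (vertical t p)) = 0 := by
        intro p
        by_cases hp : L < |p.2|
        · rw [(hhw p).2 hp, zero_mul]
        · rw [(hgw _).2, mul_zero]
          rw [hE, roofShift_iterate]
          simp only [vertical]
          have h1 := hS.birkhoffSum_le p.1 k
          have h2 : (k : ℝ) * C ≤ K * C := by
            have : (k : ℝ) ≤ K := by exact_mod_cast (not_le.1 hk).le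
            have := hS.le_roof 0
            have := hS.roof_le 0
            gcongr
            linarith
          have h3 := abs_le.1 (not_lt.1 hp)
          refine lt_of_lt_of_le ?_ (le_abs_self _)
          linarith [h3.1]
      simp only [hz, integral_zero, abs_zero]
      positivity
  have hik : ∀ k, Integrable (fun p => h p * g (E^[k] (vertical t p))) ν := fun k =>
    hhi.mul_bdd (c := M + M) (hgm.comp (hGc k).measurable).aestronglyMeasurable
      (Eventually.of_forall fun p => (hgw _).1)
  simp only [orbitSum, Finset.mul_sum]
  rw [integral_finsetSum _ fun k _ => hik k]
  refine (Finset.abs_sum_le_sum_abs _ _).trans ((Finset.sum_le_sum fun k _ => hterm k).trans ?_)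
  rw [← Finset.mul_sum]
  -- The sum of the indicators of the W k counts visits to the window, at most B of them, and is
  -- supported on Z, of measure 2(L + 1).
  have hsum : ∑ k ∈ Finset.range N, ν.real (W k) ≤ B * (2 * (L + 1)) := by
    have e1 : ∀ k, ν.real (W k) = ∫ p, (W k).indicator (fun _ => (1 : ℝ)) p ∂ν := fun k => by
      rw [integral_indicator_const _ (hWm k), smul_eq_mul, mul_one]
    have e2 : B * (2 * (L + 1)) = ∫ p, Z.indicator (fun _ => B) p ∂ν := by
      rw [integral_indicator_const _ hZm, smul_eq_mul, measureReal_def, hZν,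
        ENNReal.toReal_ofReal (by positivity), mul_comm]
    have iW : ∀ k, Integrable ((W k).indicator fun _ => (1 : ℝ)) ν := fun k =>
      (integrable_indicator_iff (hWm k)).2 (integrableOn_const (hWfin k))
    simp only [e1]
    rw [e2, ← integral_finsetSum _ fun k _ => iW k]
    refine integral_mono (integrable_finsetSum _ fun k _ => iW k)
      ((integrable_indicator_iff hZm).2 (integrableOn_const hZfin)) fun p => ?_
    by_cases hp : p ∈ Z
    · simp only [Set.indicator_of_mem hp]
      refine le_trans (le_of_eq_of_le ?_ (Nat.cast_le.2 (Finset.card_le_card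
        (s := (Finset.range N).filter fun k => p ∈ W k) (t := (Finset.range N).filter
          fun k => |(E^[k] (vertical t p)).2| ≤ L + 1) ?_))) (hS.card_visits_le N t (by positivity) p)
      · simp [Set.indicator_apply, Finset.sum_boole]
      · exact Finset.monotone_filter_right _ fun k _ hk => hk.2
    · rw [Set.indicator_of_notMem hp]
      refine (Finset.sum_eq_zero fun k _ => Set.indicator_of_notMem (fun hk => hp (hWZ k hk)) _).le
  calc ε' * ∑ k ∈ Finset.range N, ν.real (W k) ≤ ε' * (B * (2 * (L + 1))) := by gcongr
    _ = ε := by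
      rw [hε']
      field_simp

end Equidistribution

/-! ### The factor map between suspensions -/

section SuspensionMap

variable {X Y : Type*} {T : X → X} {S : Y → Y} {π : X → Y}

/-- The map of suspensions induced by a semiconjugacy compatible with the roof functions. -/
def suspensionMap (hπ : Function.Semiconj π T S) (Φ : Y → ℝ) :
    SuspensionSpace T (Φ ∘ π) → SuspensionSpace S Φ :=
  Quotient.map (fun p => (π p.1, p.2)) fun p q hpq => by
    have h : Relation.EqvGen (SuspensionRel T (Φ ∘ π)) p q := hpq
    clear hpq
    induction h with
    | rel p q h =>
      obtain ⟨x, s⟩ := h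
      have := SuspensionRel.glue (T := S) (Ψ := Φ) (π x) s
      rw [← hπ x] at this
      exact Relation.EqvGen.rel _ _ this
    | refl p => exact Relation.EqvGen.refl _
    | symm p q _ ih => exact Relation.EqvGen.symm _ _ ih
    | trans p q r _ _ ih₁ ih₂ => exact Relation.EqvGen.trans _ _ _ ih₁ ih₂

theorem suspensionMap_suspensionFlow (hπ : Function.Semiconj π T S) (Φ : Y → ℝ) (t : ℝ)
    (m : SuspensionSpace T (Φ ∘ π)) :
    suspensionMap hπ Φ (suspensionFlow T (Φ ∘ π) t m) =
      suspensionFlow S Φ t (suspensionMap hπ Φ m) := by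
  obtain ⟨p, rfl⟩ := Quotient.exists_rep m
  rfl

theorem measurable_suspensionMap [MeasurableSpace X] [MeasurableSpace Y]
    (hπ : Function.Semiconj π T S) (Φ : Y → ℝ) (hm : Measurable π) :
    Measurable (suspensionMap hπ Φ) := by
  intro V hV
  rw [measurableSet_quotient] at hV ⊢
  have h1 : Measurable fun p : X × ℝ => (π p.1, p.2) := by fun_prop
  exact h1 hV

end SuspensionMap

/-! ### Splitting off the fibre coordinate -/

section FiberSplit

variable {n : ℕ}

/-- The splitting of `𝕋^(n+1) × ℝ` into the last coordinate of the torus and the rest. -/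
def fiberSplit (p : UnitAddTorus (Fin (n + 1)) × ℝ) : UnitAddCircle × (UnitAddTorus (Fin n) × ℝ) :=
  (p.1 (Fin.last n), (torusProj p.1, p.2))

theorem measurePreserving_fiberSplit : MeasurePreserving (fiberSplit (n := n))
    (volume.prod volume) (volume.prod (volume.prod volume)) := by
  have h1 := (measurePreserving_torusSplit n).prod (MeasurePreserving.id (volume : Measure ℝ))
  have h2 := (measurePreserving_prodAssoc (volume : Measure UnitAddCircle)
    (volume : Measure (UnitAddTorus (Fin n))) (volume : Measure ℝ)).comp h1
  have : fiberSplit (n := n) =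
      (MeasurableEquiv.prodAssoc ∘ Prod.map (torusSplit n) (id : ℝ → ℝ)) := by
    funext p
    change fiberSplit p = MeasurableEquiv.prodAssoc (torusSplit n p.1, p.2)
    rw [torusSplit_apply]
    rfl
  rw [this]
  exact h2

theorem fiberSplit_add_fiberVec (p : UnitAddTorus (Fin (n + 1)) × ℝ) (w : UnitAddCircle) :
    fiberSplit (p + fiberVec w) = ((fiberSplit p).1 + w, (fiberSplit p).2) := by
  simp only [fiberSplit, fiberVec, Prod.fst_add, Prod.snd_add, add_zero, Pi.add_apply,
    Pi.single_eq_same, Prod.mk.injEq, true_and, and_true]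
  ext i
  simp [torusProj, (Fin.castSucc_lt_last i).ne]

theorem fiberAverage_indicator {J : Set UnitAddCircle} (hJ : MeasurableSet J)
    (V : Set (UnitAddTorus (Fin n) × ℝ)) (p : UnitAddTorus (Fin (n + 1)) × ℝ) :
    fiberAverage ((fiberSplit ⁻¹' (J ×ˢ V)).indicator fun _ => 1) p =
      volume.real J * (fiberSplit ⁻¹' (Set.univ ×ˢ V)).indicator (fun _ => 1) p := by
  classical
  have e : ∀ w, (fiberSplit ⁻¹' (J ×ˢ V)).indicator (fun _ => (1 : ℝ)) (p + fiberVec w) =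
      (fiberSplit ⁻¹' (Set.univ ×ˢ V)).indicator (fun _ => 1) p *
        J.indicator 1 ((fiberSplit p).1 + w) := by
    intro w
    simp only [Set.indicator_apply, Set.mem_preimage, fiberSplit_add_fiberVec, Set.mem_prod,
      Set.mem_univ, true_and, Pi.one_apply]
    by_cases h1 : (fiberSplit p).1 + w ∈ J <;> by_cases h2 : (fiberSplit p).2 ∈ V <;>
      simp [h1, h2]
  simp only [fiberAverage, e]
  rw [integral_const_mul, integral_add_left_eq_self (fun w => J.indicator (1 : UnitAddCircle → ℝ) w),
    integral_indicator_one hJ, mul_comm]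

end FiberSplit

/-! ### From continuous functions to indicators -/

section Decorrelation

theorem IsRoofSystem.windowBounded_indicator {X : Type*} [MeasurableSpace X] {μ : Measure X}
    {T : X → X} {Ψ : X → ℝ} {c C : ℝ} (h : IsRoofSystem μ T Ψ c C) {Q : Set (X × ℝ)}
    (hQ : Q ⊆ underRoof Ψ) : WindowBounded 1 C (Q.indicator fun _ => 1) := fun q => by
  by_cases hq : q ∈ Q
  · have := hQ hq
    refine ⟨by simp [hq], fun hlt => absurd hlt (not_lt.2 ?_)⟩
    rw [abs_of_nonneg this.1]
    exact this.2.le.trans (h.roof_le q.1)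
  · simp [hq]

variable {n : ℕ} {A : Matrix (Fin (n + 1)) (Fin (n + 1)) ℤ} {b : UnitAddTorus (Fin (n + 1))}
  {ψ : UnitAddTorus (Fin n) → ℝ} {v : Fin (n + 1) → ℤ} {a : ℤ}

/-- Approximate the indicators χ of Q and 1_R in L¹ by continuous f and h. The part χ - f is
controlled in L¹ (ε/2, after subtracting its average), the part 1_R - h by the sup bound on orbit
sums (ε/4), and the continuous pair by the previous section (ε/4). -/
theorem exists_abs_integral_indicator_mul_orbitSum_sub_fiberAverage_le (hA : IsUpperUnipotent A)
    (hT : Ergodic (skewTranslation A b) volume) (hψ : TorusSmooth ψ) (ha : a ≠ 0)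
    (hv : v ᵥ* A = v + a • Pi.single (Fin.last n) 1) {c C : ℝ}
    (hS : IsRoofSystem volume (skewTranslation A b) (ψ ∘ torusProj) c C)
    {R Q : Set (UnitAddTorus (Fin (n + 1)) × ℝ)} (hRm : MeasurableSet R) (hQm : MeasurableSet Q)
    (hR : R ⊆ underRoof (ψ ∘ torusProj)) (hQ : Q ⊆ underRoof (ψ ∘ torusProj))
    {ε : ℝ} (hε : 0 < ε) :
    ∃ t₀, ∀ t, t₀ ≤ t → ∀ N,
      |∫ p, R.indicator 1 p * orbitSum (skewTranslation A b) (ψ ∘ torusProj) N t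
        (fun q => Q.indicator (fun _ => 1) q - fiberAverage (Q.indicator fun _ => 1) q) p
          ∂(volume.prod volume)| ≤ ε := by
  set ν := (volume : Measure (UnitAddTorus (Fin (n + 1)))).prod (volume : Measure ℝ) with hν
  have hfin : ∀ {V}, V ⊆ underRoof (ψ ∘ torusProj) → ν V ≠ ⊤ := fun hV =>
    ((measure_mono hV).trans_lt hS.measure_underRoof_ne_top.lt_top).ne
  set χ : UnitAddTorus (Fin (n + 1)) × ℝ → ℝ := Q.indicator fun _ => 1 with hχ
  have hχm : Measurable χ := measurable_const.indicator hQm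
  have hχi : Integrable χ ν := (integrable_indicator_iff hQm).2 (integrableOn_const (hfin hQ))
  have hRi : Integrable (R.indicator (1 : UnitAddTorus (Fin (n + 1)) × ℝ → ℝ)) ν :=
    (integrable_indicator_iff hRm).2 (integrableOn_const (hfin hR))
  have hχw : WindowBounded 1 C χ := hS.windowBounded_indicator hQ
  obtain ⟨f, hfc, hfχ, hf, hfi⟩ := hχi.exists_hasCompactSupport_integral_sub_le
    (ε := ε / 4) (by positivity)
  obtain ⟨M, L₁, hL₁, hfw⟩ := hfc.exists_windowBounded hf
  set L := max L₁ C
  have hL : 0 ≤ L := hL₁.trans (le_max_left _ _)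
  replace hfw : WindowBounded M L f := hfw.mono (le_max_left _ _)
  replace hχw : WindowBounded 1 L χ := hχw.mono (le_max_right _ _)
  have hM : 0 ≤ M := (abs_nonneg _).trans (hfw 0).1
  have hc := hS.pos
  set B : ℝ := (M + M) * (2 * L / c + 1)
  have hB : 0 ≤ B := by positivity
  -- h is chosen after f: its accuracy depends on B, which involves the bound and the window of f.
  obtain ⟨h, hhc, hhR, hh, hhi⟩ := hRi.exists_hasCompactSupport_integral_sub_le
    (ε := ε / 4 / (B + 1)) (by positivity)
  obtain ⟨t₀, ht₀⟩ := exists_abs_integral_mul_orbitSum_sub_fiberAverage_le hA hT hψ ha hv hS hhc hh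
    hfc hf (ε := ε / 4) (by positivity)
  refine ⟨t₀, fun t ht N => ?_⟩
  set O := orbitSum (skewTranslation A b) (ψ ∘ torusProj) N t with hO
  set d : UnitAddTorus (Fin (n + 1)) × ℝ → ℝ := fun q => χ q - f q with hd
  have hdm : Measurable d := hχm.sub hf.measurable
  have hdw : WindowBounded (1 + M) L d := hχw.sub hfw
  set u : UnitAddTorus (Fin (n + 1)) × ℝ → ℝ := fun q => d q - fiberAverage d q with hu
  have hum : Measurable u := hdm.sub (measurable_fiberAverage hdm)
  have huw : WindowBounded (1 + M + (1 + M)) L u := hdw.sub hdw.fiberAverage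
  set g : UnitAddTorus (Fin (n + 1)) × ℝ → ℝ := fun q => f q - fiberAverage f q with hg
  have hgm : Measurable g := hf.measurable.sub (measurable_fiberAverage hf.measurable)
  have hgw : WindowBounded (M + M) L g := hfw.sub hfw.fiberAverage
  have hsplit : ∀ p, O (fun q => χ q - fiberAverage χ q) p = O u p + O g p := fun p => by
    simp only [hO, orbitSum, ← Finset.sum_add_distrib]
    refine Finset.sum_congr rfl fun k _ => ?_
    simp only [hu, hg, hd]
    rw [fiberAverage_sub hχw hχm hfw hf.measurable]
    ring
  have hdI : ∫⁻ p, ‖d p‖ₑ ∂ν ≤ ENNReal.ofReal (ε / 4) := by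
    have hdi : Integrable d ν := hχi.sub hfi
    rw [← ofReal_integral_norm_eq_lintegral_enorm hdi]
    exact ENNReal.ofReal_le_ofReal hfχ
  have huI : ∫⁻ p, ‖u p‖ₑ ∂ν ≤ ENNReal.ofReal (ε / 2) := by
    calc ∫⁻ p, ‖u p‖ₑ ∂ν ≤ ∫⁻ p, (‖d p‖ₑ + ‖fiberAverage d p‖ₑ) ∂ν :=
          lintegral_mono fun p => enorm_sub_le
      _ = ∫⁻ p, ‖d p‖ₑ ∂ν + ∫⁻ p, ‖fiberAverage d p‖ₑ ∂ν := lintegral_add_left hdm.enorm _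
      _ ≤ ENNReal.ofReal (ε / 4) + ENNReal.ofReal (ε / 4) :=
          add_le_add hdI ((lintegral_enorm_fiberAverage_le hdm).trans hdI)
      _ = ENNReal.ofReal (ε / 2) := by
          rw [← ENNReal.ofReal_add (by positivity) (by positivity)]
          congr 1
          ring
  have b1 : |∫ p, R.indicator 1 p * O u p ∂ν| ≤ ε / 2 :=
    hS.abs_integral_indicator_mul_orbitSum_le N t hR hum (by positivity) huI
  have b2 : |∫ p, (R.indicator 1 p - h p) * O g p ∂ν| ≤ ε / 4 := by
    refine (hS.abs_integral_mul_orbitSum_le N t hL hgw (hRi.sub hhi)).trans ?_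
    calc _ ≤ ε / 4 / (B + 1) * (B + 1) := by
          gcongr
          · exact hhR
          · exact le_add_of_nonneg_right zero_le_one
      _ = ε / 4 := by field_simp
  have b3 : |∫ p, h p * O g p ∂ν| ≤ ε / 4 := ht₀ t ht N
  have i1 : Integrable (fun p => R.indicator 1 p * O u p) ν :=
    hS.integrable_mul_orbitSum N t hL huw hum hRi
  have i2 : Integrable (fun p => (R.indicator 1 p - h p) * O g p) ν :=
    hS.integrable_mul_orbitSum N t hL hgw hgm (hRi.sub hhi)
  have i3 : Integrable (fun p => h p * O g p) ν := hS.integrable_mul_orbitSum N t hL hgw hgm hhi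
  have e : ∀ p, R.indicator 1 p * O (fun q => χ q - fiberAverage χ q) p =
      R.indicator 1 p * O u p + ((R.indicator 1 p - h p) * O g p + h p * O g p) := fun p => by
    rw [hsplit]
    ring
  have i23 : Integrable (fun p => (R.indicator 1 p - h p) * O g p + h p * O g p) ν := i2.add i3
  simp only [e]
  rw [integral_add i1 i23, integral_add i2 i3]
  refine (abs_add_le _ _).trans ((add_le_add b1 ((abs_add_le _ _).trans (add_le_add b2 b3))).trans ?_)
  linarith

end Decorrelation

/-! ### Product sets in the suspension and the two implications -/

section Main

theorem exists_isRoofSystem_constants {d : ℕ} {ψ : UnitAddTorus (Fin d) → ℝ} (hψ : Continuous ψ)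
    (hpos : ∀ y, 0 < ψ y) : ∃ c C : ℝ, 0 < c ∧ (∀ y, c ≤ ψ y) ∧ ∀ y, ψ y ≤ C := by
  obtain ⟨y, -, hy⟩ := isCompact_univ.exists_isMinOn Set.univ_nonempty hψ.continuousOn
  obtain ⟨z, -, hz⟩ := isCompact_univ.exists_isMaxOn Set.univ_nonempty hψ.continuousOn
  exact ⟨ψ y, ψ z, hpos y, fun x => hy (Set.mem_univ x), fun x => hz (Set.mem_univ x)⟩

variable {n : ℕ} {A : Matrix (Fin (n + 1)) (Fin (n + 1)) ℤ} {b : UnitAddTorus (Fin (n + 1))}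
  {ψ : UnitAddTorus (Fin n) → ℝ} {c C : ℝ}

/-- The set `Π⁻¹ V ∩ λ⁻¹ J`, where `Π` is the factor map of suspensions and `λ` the last coordinate
of the representative under the roof. -/
def fiberBox (hA : IsUpperUnipotent A) (b : UnitAddTorus (Fin (n + 1)))
    (σ : SuspensionSpace (skewTranslation A b) (ψ ∘ torusProj) → UnitAddTorus (Fin (n + 1)) × ℝ)
    (V : Set (SuspensionSpace (skewTranslation (dropLast A) (torusProj b)) ψ))
    (J : Set UnitAddCircle) : Set (SuspensionSpace (skewTranslation A b) (ψ ∘ torusProj)) :=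
  suspensionMap (torusProj_skewTranslation hA b) ψ ⁻¹' V ∩ {m | (σ m).1 (Fin.last n) ∈ J}

theorem underRoof_inter_preimage_fiberBox (hA : IsUpperUnipotent A)
    {σ : SuspensionSpace (skewTranslation A b) (ψ ∘ torusProj) → UnitAddTorus (Fin (n + 1)) × ℝ}
    (hσ : ∀ p ∈ underRoof (ψ ∘ torusProj), σ (Quotient.mk _ p) = p)
    (V : Set (SuspensionSpace (skewTranslation (dropLast A) (torusProj b)) ψ))
    (J : Set UnitAddCircle) :
    underRoof (ψ ∘ torusProj) ∩ Quotient.mk _ ⁻¹' fiberBox hA b σ V J =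
      fiberSplit ⁻¹' (J ×ˢ (underRoof ψ ∩ Quotient.mk _ ⁻¹' V)) := by
  ext p
  constructor
  · rintro ⟨hp, hV, hJ⟩
    refine ⟨?_, hp, hV⟩
    have hJ' : (σ (Quotient.mk _ p)).1 (Fin.last n) ∈ J := hJ
    rwa [hσ p hp] at hJ'
  · rintro ⟨hJ, hp, hV⟩
    refine ⟨hp, hV, ?_⟩
    change (σ (Quotient.mk _ p)).1 (Fin.last n) ∈ J
    rwa [hσ p hp]

theorem measurableSet_fiberBox (hA : IsUpperUnipotent A)
    {σ : SuspensionSpace (skewTranslation A b) (ψ ∘ torusProj) → UnitAddTorus (Fin (n + 1)) × ℝ}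
    (hσm : Measurable σ)
    {V : Set (SuspensionSpace (skewTranslation (dropLast A) (torusProj b)) ψ)}
    (hV : MeasurableSet V) {J : Set UnitAddCircle} (hJ : MeasurableSet J) :
    MeasurableSet (fiberBox hA b σ V J) :=
  (measurable_suspensionMap _ _ continuous_torusProj.measurable hV).inter
    (((measurable_pi_apply (Fin.last n)).comp (measurable_fst.comp hσm)) hJ)

theorem measureReal_fiberBox (hA : IsUpperUnipotent A)
    (hS : IsRoofSystem volume (skewTranslation A b) (ψ ∘ torusProj) c C)
    (hS' : IsRoofSystem volume (skewTranslation (dropLast A) (torusProj b)) ψ c C)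
    {σ : SuspensionSpace (skewTranslation A b) (ψ ∘ torusProj) → UnitAddTorus (Fin (n + 1)) × ℝ}
    (hσm : Measurable σ) (hσ : ∀ p ∈ underRoof (ψ ∘ torusProj), σ (Quotient.mk _ p) = p)
    {V : Set (SuspensionSpace (skewTranslation (dropLast A) (torusProj b)) ψ)}
    (hV : MeasurableSet V) {J : Set UnitAddCircle} (hJ : MeasurableSet J) :
    (suspensionMeasure volume (skewTranslation A b) (ψ ∘ torusProj)).real (fiberBox hA b σ V J) =
      volume.real J *
        (suspensionMeasure volume (skewTranslation (dropLast A) (torusProj b)) ψ).real V := by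
  have hsplit : ∀ (J : Set UnitAddCircle) (V : Set (UnitAddTorus (Fin n) × ℝ)), MeasurableSet J →
      MeasurableSet V →
      ((volume : Measure (UnitAddTorus (Fin (n + 1)))).prod (volume : Measure ℝ))
        (fiberSplit ⁻¹' (J ×ˢ V)) = volume J *
          ((volume : Measure (UnitAddTorus (Fin n))).prod (volume : Measure ℝ)) V :=
    fun J V hJ hV => by
      rw [measurePreserving_fiberSplit.measure_preimage (hJ.prod hV).nullMeasurableSet,
        Measure.prod_prod]
  have hD : underRoof (ψ ∘ torusProj (n := n)) = fiberSplit ⁻¹' (Set.univ ×ˢ underRoof ψ) := by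
    ext p
    exact ⟨fun hp => ⟨Set.mem_univ _, hp⟩, fun hp => hp.2⟩
  have hV' : MeasurableSet (underRoof ψ ∩ Quotient.mk (suspensionSetoid _ _) ⁻¹' V) :=
    hS'.measurableSet_underRoof.inter (measurable_suspension_mk _ _ hV)
  rw [measureReal_def, hS.suspensionMeasure_apply (measurableSet_fiberBox hA hσm hV hJ),
    underRoof_inter_preimage_fiberBox hA hσ, hsplit _ _ hJ hV', hD,
    hsplit _ _ MeasurableSet.univ hS'.measurableSet_underRoof, measure_univ, one_mul,
    measureReal_def, measureReal_def, hS'.suspensionMeasure_apply hV]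
  simp only [ENNReal.toReal_mul]
  ring

theorem fiberBox_univ (hA : IsUpperUnipotent A)
    (σ : SuspensionSpace (skewTranslation A b) (ψ ∘ torusProj) → UnitAddTorus (Fin (n + 1)) × ℝ)
    (V : Set (SuspensionSpace (skewTranslation (dropLast A) (torusProj b)) ψ)) :
    fiberBox hA b σ V Set.univ = suspensionMap (torusProj_skewTranslation hA b) ψ ⁻¹' V := by
  ext m
  simp [fiberBox]

/-- The pair F of fibre coordinate and factor map has a measurable left inverse G, built from a
section below. Hence every measurable R is F⁻¹(G⁻¹R), and F is measurable for the generated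
σ-algebra. -/
theorem generateFrom_fiberBox (hA : IsUpperUnipotent A)
    (hS' : IsRoofSystem volume (skewTranslation (dropLast A) (torusProj b)) ψ c C)
    {σ : SuspensionSpace (skewTranslation A b) (ψ ∘ torusProj) → UnitAddTorus (Fin (n + 1)) × ℝ}
    (hσm : Measurable σ) (hσD : ∀ m, σ m ∈ underRoof (ψ ∘ torusProj))
    (hσmk : ∀ m, Quotient.mk _ (σ m) = m) :
    (inferInstance : MeasurableSpace (SuspensionSpace (skewTranslation A b) (ψ ∘ torusProj))) =
      MeasurableSpace.generateFrom
        {S | ∃ V J, MeasurableSet V ∧ MeasurableSet J ∧ S = fiberBox hA b σ V J} := by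
  set 𝒞 := {S | ∃ V J, MeasurableSet V ∧ MeasurableSet J ∧ S = fiberBox (ψ := ψ) hA b σ V J} with h𝒞
  refine le_antisymm ?_ (MeasurableSpace.generateFrom_le ?_)
  · obtain ⟨σ', hσ'm, -, -, hσ'⟩ := hS'.exists_measurable_section
    set F : SuspensionSpace (skewTranslation A b) (ψ ∘ torusProj) → UnitAddCircle ×
        SuspensionSpace (skewTranslation (dropLast A) (torusProj b)) ψ := fun m =>
      ((σ m).1 (Fin.last n), suspensionMap (torusProj_skewTranslation hA b) ψ m) with hF
    set G : UnitAddCircle × SuspensionSpace (skewTranslation (dropLast A) (torusProj b)) ψ →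
        SuspensionSpace (skewTranslation A b) (ψ ∘ torusProj) := fun z =>
      Quotient.mk _ ((torusSplit n).symm (z.1, (σ' z.2).1), (σ' z.2).2) with hG
    have hGm : Measurable G := by
      refine (measurable_suspension_mk _ _).comp (Measurable.prodMk ?_ ?_)
      · exact (torusSplit n).symm.measurable.comp
          (measurable_fst.prodMk (measurable_fst.comp (hσ'm.comp measurable_snd)))
      · exact measurable_snd.comp (hσ'm.comp measurable_snd)
    have hGF : ∀ m, G (F m) = m := by
      intro m
      have h1 : suspensionMap (torusProj_skewTranslation hA b) ψ m =
          Quotient.mk _ (torusProj (σ m).1, (σ m).2) := by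
        conv_lhs => rw [← hσmk m]
        rfl
      have h2 : σ' (suspensionMap (torusProj_skewTranslation hA b) ψ m) =
          (torusProj (σ m).1, (σ m).2) := by
        rw [h1]
        exact hσ' _ (hσD m)
      simp only [hG, hF, h2]
      rw [← torusSplit_apply, MeasurableEquiv.symm_apply_apply]
      exact hσmk m
    have hFm : Measurable[MeasurableSpace.generateFrom 𝒞] F := by
      refine Measurable.prodMk (m := .generateFrom 𝒞) ?_ ?_
      · intro J hJ
        refine MeasurableSpace.measurableSet_generateFrom ⟨Set.univ, J, MeasurableSet.univ, hJ, ?_⟩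
        ext m
        simp [fiberBox]
      · intro V hV
        exact MeasurableSpace.measurableSet_generateFrom
          ⟨V, Set.univ, hV, MeasurableSet.univ, (fiberBox_univ hA σ V).symm⟩
    intro R hR
    have h1 : R = F ⁻¹' (G ⁻¹' R) := by
      ext m
      simp [hGF]
    rw [h1]
    exact hFm (hGm hR)
  · rintro _ ⟨V, J, hV, hJ, rfl⟩
    exact measurableSet_fiberBox hA hσm hV hJ

theorem isPiSystem_fiberBox (hA : IsUpperUnipotent A)
    (σ : SuspensionSpace (skewTranslation A b) (ψ ∘ torusProj) → UnitAddTorus (Fin (n + 1)) × ℝ) :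
    IsPiSystem {S | ∃ V J, MeasurableSet V ∧ MeasurableSet J ∧ S = fiberBox (ψ := ψ) hA b σ V J} := by
  rintro _ ⟨V, J, hV, hJ, rfl⟩ _ ⟨V', J', hV', hJ', rfl⟩ -
  refine ⟨V ∩ V', J ∩ J', hV.inter hV', hJ.inter hJ', ?_⟩
  ext m
  simp only [fiberBox, Set.mem_inter_iff, Set.mem_preimage]
  constructor
  · rintro ⟨⟨h1, h2⟩, h3, h4⟩
    exact ⟨⟨h1, h3⟩, h2, h4⟩
  · rintro ⟨⟨h1, h3⟩, h2, h4⟩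
    exact ⟨⟨h1, h2⟩, h3, h4⟩

/-- The factor map intertwines the flows and carries one measure to the other, so correlations below
are correlations of preimages. -/
theorem suspensionMixing_dropLast (hA : IsUpperUnipotent A)
    (hS : IsRoofSystem volume (skewTranslation A b) (ψ ∘ torusProj) c C)
    (hS' : IsRoofSystem volume (skewTranslation (dropLast A) (torusProj b)) ψ c C)
    (hmix : SuspensionMixing (skewTranslation A b) (ψ ∘ torusProj)) :
    SuspensionMixing (skewTranslation (dropLast A) (torusProj b)) ψ := by
  have := hS.isProbabilityMeasure_suspensionMeasure
  have := hS'.isProbabilityMeasure_suspensionMeasure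
  obtain ⟨σ, hσm, hσD, hσmk, hσ⟩ := hS.exists_measurable_section
  have hm := measurable_suspensionMap (torusProj_skewTranslation hA b) ψ
    continuous_torusProj.measurable
  have hmeas : ∀ V, MeasurableSet V →
      suspensionMeasure volume (skewTranslation A b) (ψ ∘ torusProj)
        (suspensionMap (torusProj_skewTranslation hA b) ψ ⁻¹' V) =
      suspensionMeasure volume (skewTranslation (dropLast A) (torusProj b)) ψ V := fun V hV => by
    have := measureReal_fiberBox hA hS hS' hσm hσ hV MeasurableSet.univ
    rw [fiberBox_univ, probReal_univ, one_mul] at this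
    exact (ENNReal.toReal_eq_toReal_iff' (measure_ne_top _ _) (measure_ne_top _ _)).1 this
  refine ⟨hS'.measurePreserving_suspensionFlow, fun R Q hR hQ => ?_⟩
  have := hmix.2 _ _ (hm hR) (hm hQ)
  rw [hmeas R hR, hmeas Q hQ] at this
  refine this.congr fun t => ?_
  rw [← hmeas _ (hR.inter (measurable_suspensionFlow _ _ t hQ))]
  congr 1
  ext m
  simp only [Set.mem_inter_iff, Set.mem_preimage]
  have hflow : suspensionMap (torusProj_skewTranslation hA b) ψ (suspensionFlow _ _ t m) = _ :=
    suspensionMap_suspensionFlow _ ψ t m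
  exact iff_of_eq (congrArg (fun z => _ ∧ z ∈ Q) hflow)

theorem suspensionMixing_of_dropLast (hA : IsUpperUnipotent A)
    (hT : Ergodic (skewTranslation A b) volume) (hψ : TorusSmooth ψ)
    {v : Fin (n + 1) → ℤ} {a : ℤ} (ha : a ≠ 0)
    (hv : v ᵥ* A = v + a • Pi.single (Fin.last n) 1)
    (hS : IsRoofSystem volume (skewTranslation A b) (ψ ∘ torusProj) c C)
    (hS' : IsRoofSystem volume (skewTranslation (dropLast A) (torusProj b)) ψ c C)
    (hmix : SuspensionMixing (skewTranslation (dropLast A) (torusProj b)) ψ) :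
    SuspensionMixing (skewTranslation A b) (ψ ∘ torusProj) := by
  have := hS.isProbabilityMeasure_suspensionMeasure
  have := hS'.isProbabilityMeasure_suspensionMeasure
  obtain ⟨σ, hσm, hσD, hσmk, hσ⟩ := hS.exists_measurable_section
  refine IsMixingFlow.of_isPiSystem hS.measurePreserving_suspensionFlow
    (generateFrom_fiberBox hA hS' hσm hσD hσmk) (isPiSystem_fiberBox hA σ) ?_
  rintro _ ⟨V', J', hV', hJ', rfl⟩ _ ⟨V, J, hV, hJ, rfl⟩
  set m := suspensionMeasure volume (skewTranslation A b) (ψ ∘ torusProj) with hm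
  set m' := suspensionMeasure volume (skewTranslation (dropLast A) (torusProj b)) ψ with hm'
  set φ := suspensionFlow (skewTranslation A b) (ψ ∘ torusProj) with hφ
  set φ' := suspensionFlow (skewTranslation (dropLast A) (torusProj b)) ψ with hφ'
  set R := fiberBox hA b σ V' J' with hR
  have hRm : MeasurableSet R := measurableSet_fiberBox hA hσm hV' hJ'
  -- With a full fibre on the side of Q, the correlation is exactly `volume.real J'` times a
  -- correlation of the factor; mixing below enters only here.
  have hbase : Tendsto (fun t => m.real (R ∩ φ t ⁻¹' fiberBox hA b σ V Set.univ)) atTop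
      (𝓝 (volume.real J' * (m'.real V' * m'.real V))) := by
    have h1 : Tendsto (fun t => m'.real (V' ∩ φ' t ⁻¹' V)) atTop (𝓝 (m'.real V' * m'.real V)) := by
      have := hmix.2 V' V hV' hV
      rw [← ENNReal.tendsto_toReal_iff (fun t => measure_ne_top _ _)
        (ENNReal.mul_ne_top (measure_ne_top _ _) (measure_ne_top _ _)), ENNReal.toReal_mul] at this
      exact this
    refine (h1.const_mul (volume.real J')).congr fun t => ?_
    rw [← measureReal_fiberBox hA hS hS' hσm hσ
      (hV'.inter (measurable_suspensionFlow _ _ t hV)) hJ']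
    congr 1
    ext z
    have hflow : suspensionMap (torusProj_skewTranslation hA b) ψ (φ t z) =
        φ' t (suspensionMap (torusProj_skewTranslation hA b) ψ z) :=
      suspensionMap_suspensionFlow _ ψ t z
    simp only [hR, fiberBox, Set.mem_inter_iff, Set.mem_preimage]
    constructor
    · rintro ⟨⟨h2, h3⟩, h4⟩
      exact ⟨⟨h2, h4⟩, by rwa [hflow], Set.mem_univ _⟩
    · rintro ⟨⟨h2, h4⟩, h3, -⟩
      exact ⟨⟨h2, by rwa [hflow] at h3⟩, h4⟩
  -- Replacing the arc J by the full fibre times the length of J is exactly taking the fibre average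
  -- of the indicator, so decorrelation applies.
  have hdiff : Tendsto (fun t => m.real (R ∩ φ t ⁻¹' fiberBox hA b σ V J) -
      volume.real J * m.real (R ∩ φ t ⁻¹' fiberBox hA b σ V Set.univ)) atTop (𝓝 0) := by
    rw [Metric.tendsto_atTop]
    intro ε hε
    set κ := ((volume : Measure (UnitAddTorus (Fin (n + 1)))).prod (volume : Measure ℝ)).real
      (underRoof (ψ ∘ torusProj)) with hκ
    have hκ0 : 0 < κ := ENNReal.toReal_pos hS.measure_underRoof_ne_zero hS.measure_underRoof_ne_top
    have hbox : ∀ J, MeasurableSet J → MeasurableSet (underRoof (ψ ∘ torusProj) ∩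
        Quotient.mk (suspensionSetoid (skewTranslation A b) (ψ ∘ torusProj)) ⁻¹'
          fiberBox hA b σ V J) := fun J hJ =>
      hS.measurableSet_underRoof.inter
        (measurable_suspension_mk _ _ (measurableSet_fiberBox hA hσm hV hJ))
    have hRm' := hS.measurableSet_underRoof.inter (measurable_suspension_mk _ _ hRm)
    have hC : 0 ≤ C := hS.pos.le.trans ((hS.le_roof 0).trans (hS.roof_le 0))
    have hint := fun J hJ (N : ℕ) (t : ℝ) => hS.integrable_mul_orbitSum N t hC
      (hS.windowBounded_indicator Set.inter_subset_left) (measurable_const.indicator (hbox J hJ))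
      ((integrable_indicator_iff (f := 1) hRm').2 (integrableOn_const
        ((measure_mono Set.inter_subset_left).trans_lt hS.measure_underRoof_ne_top.lt_top).ne))
    obtain ⟨t₀, ht₀⟩ := exists_abs_integral_indicator_mul_orbitSum_sub_fiberAverage_le hA hT hψ ha hv
      hS hRm' (hbox J hJ)
      Set.inter_subset_left Set.inter_subset_left (ε := ε / 2 * κ) (by positivity)
    refine ⟨max t₀ 0, fun t ht => ?_⟩
    have ht0 : 0 ≤ t := (le_max_right _ _).trans ht
    obtain ⟨N, hN⟩ := exists_nat_gt ((t + C) / c)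
    rw [div_lt_iff₀ hS.pos] at hN
    have key := ht₀ t ((le_max_left _ _).trans ht) N
    rw [hS.measureReal_inter_preimage_suspensionFlow ht0 hN.le hRm
        (measurableSet_fiberBox hA hσm hV hJ),
      hS.measureReal_inter_preimage_suspensionFlow ht0 hN.le hRm
        (measurableSet_fiberBox hA hσm hV MeasurableSet.univ), Real.dist_eq, sub_zero,
      mul_left_comm, ← mul_sub, ← integral_const_mul, ← integral_sub (hint J hJ N t)
        ((hint Set.univ MeasurableSet.univ N t).const_mul _), abs_mul, abs_inv, abs_of_pos hκ0,
      inv_mul_lt_iff₀ hκ0]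
    refine lt_of_le_of_lt (le_of_eq_of_le ?_ key) (by nlinarith)
    congr 1
    refine integral_congr_ae (Eventually.of_forall fun p => ?_)
    simp only [orbitSum, Finset.mul_sum, ← Finset.sum_sub_distrib]
    refine Finset.sum_congr rfl fun k _ => ?_
    rw [underRoof_inter_preimage_fiberBox hA hσ V J, underRoof_inter_preimage_fiberBox hA hσ V,
      fiberAverage_indicator hJ]
    ring
  have hlim := hdiff.add (hbase.const_mul (volume.real J))
  simp only [sub_add_cancel, zero_add] at hlim
  rw [measureReal_fiberBox hA hS hS' hσm hσ hV' hJ', measureReal_fiberBox hA hS hS' hσm hσ hV hJ]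
  convert hlim using 2
  ring

end Main

theorem proposition2p1 (n : ℕ) (hn : 1 ≤ n)
    (A : Matrix (Fin (n + 1)) (Fin (n + 1)) ℤ) (hA : IsUpperUnipotent A)
    (b : UnitAddTorus (Fin (n + 1)))
    (hT : Ergodic (skewTranslation A b) volume)
    (hv : ∃ (v : Fin (n + 1) → ℤ) (a : ℤ), a ≠ 0 ∧ v ᵥ* A = v + a • Pi.single (Fin.last n) 1)
    (ψ : UnitAddTorus (Fin n) → ℝ) (hψ : TorusSmooth ψ) (hpos : ∀ y, 0 < ψ y) :
    SuspensionMixing (skewTranslation A b) (ψ ∘ torusProj) ↔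
      SuspensionMixing (skewTranslation (dropLast A) (torusProj b)) ψ := by
  obtain ⟨v, a, ha, hv⟩ := hv
  obtain ⟨c, C, hc, hcψ, hψC⟩ := exists_isRoofSystem_constants hψ.continuous hpos
  have hS : IsRoofSystem volume (skewTranslation A b) (ψ ∘ torusProj) c C :=
    ⟨hT.toMeasurePreserving, hA.exists_measurableEquiv b,
      (hψ.continuous.comp continuous_torusProj).measurable, hc, fun _ => hcψ _, fun _ => hψC _⟩
  have hS' : IsRoofSystem volume (skewTranslation (dropLast A) (torusProj b)) ψ c C :=
    ⟨(ergodic_skewTranslation_dropLast hA hT).toMeasurePreserving,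
      hA.dropLast.exists_measurableEquiv _, hψ.continuous.measurable, hc, hcψ, hψC⟩
  exact ⟨suspensionMixing_dropLast hA hS hS', suspensionMixing_of_dropLast hA hT hψ ha hv hS hS'⟩
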